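/- **Setup.** Let $\Gamma$ be a finite connected graph (loops and multiple edges allowed). A *quasi-stable model* $\widehat\Gamma$ of $\Gamma$ is obtained by inserting one *exceptional* vertex in the interior of each edge of some subset of $E(\Gamma)$. Functions on $V(\Gamma)$ are extended by $0$ to the exceptional vertices. Let $d\in\mathbb Z$ and let $\theta:V(\Gamma)\to\mathbb R$ satisfy $\sum_v\theta(v)=d$. A divisor $D\in\mathbb Z^{V(\widehat\Gamma)}$ with $D(x)=1$ at every exceptional vertex $x$ is *$\theta$-semistable* if $$\theta(G)-\tfrac12\mathrm{val}(G)\le D(G)\le\theta(G)+\tfrac12\mathrm{val}(G)\qquad\text{for all }G\subseteq V(\widehat\Gamma),$$ where $\theta(G)=\sum_{v\in G}\theta(v)$, $D(G)=\sum_{v\in G}D(v)$, and $\mathrm{val}(G)$ is the number of edges joining $G$ to its complement. It is *$\theta$-stable* if moreover the inequalities are strict whenever neither $G$ nor its complement consists only of exceptional vertices. Assume that $\theta$ is *nondegenerate*: on every quasi-stable model of $\Gamma$, every $\theta$-semistable divisor is $\theta$-stable. A *flow* on $\widehat\Gamma$ is an integer function on oriented edges that changes sign when the orientation is reversed. Its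 divisor is $\mathrm{div}(f)(v)=\sum_{\vec e\to v}f(\vec e)$, and $H_1(\widehat\Gamma)=\ker(\mathrm{div})$. A flow is *acyclic* if there is no oriented simple cycle along which it is everywhere $\ge 0$ and somewhere $>0$. For edge lengths $\widehat\ell$ put $\langle f,g\rangle_{\widehat\ell}=\tfrac12\sum_{\vec e}\widehat\ell(e)f(\vec e)g(\vec e)$. Let $P$ be a sharp fine saturated monoid and let $\ell:E(\Gamma)\to P\setminus\{0\}$. Put $\sigma_\Gamma=\mathrm{Hom}(P,\mathbb R_{\ge0})$, with lattice $\mathrm{Hom}(P,\mathbb Z)\subset\mathrm{Hom}(P,\mathbb R)$. For a quasi-stable model $\widehat\Gamma$ put $\sigma_{\widehat\Gamma}=\sigma_\Gamma\times_{\mathbb R_{\ge0}^{E(\Gamma)}}\mathbb R_{\ge0}^{E(\widehat\Gamma)}$, i.e. the set of pairs $(p,\widehat\ell)$ such that, for every edge $e$ of $\Gamma$, $p(\ell(e))$ is the sum of the $\widehat\ell$-lengths of the parts of $e$; its lattice is $\mathrm{Hom}(P,\mathbb Z)\times\mathbb Z^{E(\widehat\Gamma)}$. Let $\mathsf{pr}:\sigma_{\widehat\Gamma}\to\sigma_\Gamma$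 be the projection. For a flow $I$ on $\widehat\Gamma$ let $$\tau_{\widehat\Gamma,I}=\{(p,\widehat\ell)\in\sigma_{\widehat\Gamma}\;:\;\langle\gamma,I\rangle_{\widehat\ell}=0\text{ for all }\gamma\in H_1(\widehat\Gamma)\},\qquad \sigma_{\widehat\Gamma,I}=\mathsf{pr}(\tau_{\widehat\Gamma,I}).$$ Let $\delta\in\mathbb Z^{V(\Gamma)}$ be a multidegree of total degree $d$. Consider all triples $(\widehat\Gamma,D,I)$ where $\widehat\Gamma$ is a quasi-stable model of $\Gamma$, $D$ is a $\theta$-stable divisor on $\widehat\Gamma$, and $I$ is an acyclic flow on $\widehat\Gamma$ with $\mathrm{div}(I)=\delta-D$. **Lemma.** For each such triple, $\mathsf{pr}$ restricts to an isomorphism of cones with integral structure $\tau_{\widehat\Gamma,I}\to\sigma_{\widehat\Gamma,I}$. Moreover, the collection of all cones $\sigma_{\widehat\Gamma,I}$ together with their faces is a (finite) fan of strongly convex rational polyhedral cones with support $\sigma_\Gamma$. In particular, let $\Gamma$ be a stable graph of type $(g,n)$, $k\in\mathbb Z$, $A\in\mathbb Z^n$ with $\sum_i a_i=k(2g-2+n)$,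 $d=0$, and $$\delta(v)=\deg_{k,A}(v)=k(2g(v)-2+n(v))-\sum_{i\text{ at }v}a_i ,$$ where $n(v)$ is the number of half-edges and legs at $v$. Then the same holds with $\sigma_\Gamma=\mathbb R_{\ge0}^{E(\Gamma)}$, $\sigma_{\widehat\Gamma}=\mathbb R_{\ge0}^{E(\widehat\Gamma)}$ with their standard integral structures, and $\mathsf{pr}:\sigma_{\widehat\Gamma}\to\sigma_\Gamma$ the map that adds the lengths of the two parts of each subdivided edge (with $\tau_{\widehat\Gamma,I}\subseteq\mathbb R_{\ge0}^{E(\widehat\Gamma)}$ defined by the same condition). -/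

import Mathlib

/-! ### Graphs, flows, divisors -/

/-- A graph with vertex set `V` and edge set `E`; loops and multiple edges are allowed.
The functions `src`, `tgt` record the two ends of each edge; the resulting orientation is an
auxiliary reference orientation. -/
structure Multigraph (V E : Type*) where
  src : E → V
  tgt : E → V

/-- Flows, identified with integer functions on edges by means of the reference orientation. -/
abbrev GraphFlow (E : Type*) := E → ℤ

/-- The value of a flow on an oriented edge. `(e, true)` is `e` with its reference orientation,
`(e, false)` is `e` with the opposite one; so `f` of the reversed edge is minus `f` of the edge. -/
def GraphFlow.val {E : Type*} (f : GraphFlow E) (a : E × Bool) : ℤ :=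
  if a.2 then f a.1 else -f a.1

namespace Multigraph

variable {V E : Type*} (Γ : Multigraph V E)

/-- The vertex an oriented edge points to. -/
def head (a : E × Bool) : V := if a.2 then Γ.tgt a.1 else Γ.src a.1

/-- The vertex an oriented edge starts from. -/
def tail (a : E × Bool) : V := if a.2 then Γ.src a.1 else Γ.tgt a.1

/-- Connected, in particular non-empty. -/
def Connected : Prop :=
  Nonempty V ∧ ∀ u v : V, Relation.EqvGen (fun x y => ∃ e, Γ.src e = x ∧ Γ.tgt e = y) u v

/-- `c 0, …, c m` are oriented edges forming a cycle without self-intersection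
(indices are taken cyclically; `m = 0` is a loop). -/
def IsCycle {m : ℕ} (c : Fin (m + 1) → E × Bool) : Prop :=
  (∀ i, Γ.head (c i) = Γ.tail (c (i + 1))) ∧
    Function.Injective (fun i => Γ.tail (c i)) ∧ Function.Injective (fun i => (c i).1)

/-- A flow is acyclic if there is no cycle along which it is everywhere nonnegative and
somewhere positive. -/
def IsAcyclic (f : GraphFlow E) : Prop :=
  ¬ ∃ (m : ℕ) (c : Fin (m + 1) → E × Bool), Γ.IsCycle c ∧
    (∀ i, 0 ≤ f.val (c i)) ∧ ∃ i, 0 < f.val (c i)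

/-- The divisor of a flow: at `v`, the sum of the flow over the oriented edges pointing to `v`. -/
def div [Fintype E] [DecidableEq V] : GraphFlow E →+ (V → ℤ) where
  toFun f v := ∑ a : E × Bool with Γ.head a = v, f.val a
  map_zero' := by
    funext v
    simp [GraphFlow.val]
  map_add' f g := by
    funext v
    rw [Pi.add_apply, ← Finset.sum_add_distrib]
    refine Finset.sum_congr rfl fun a _ => ?_
    unfold GraphFlow.val
    split <;> simp [add_comm]

/-- First homology, as a group of flows. -/
def H1 [Fintype E] [DecidableEq V] : AddSubgroup (GraphFlow E) := Γ.div.ker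

/-- The pairing of two flows for a length assignment. -/
noncomputable def _root_.GraphFlow.pairing [Fintype E] (len : E → ℝ) (f g : GraphFlow E) : ℝ :=
  (1 / 2) * ∑ a : E × Bool, len a.1 * (f.val a : ℝ) * (g.val a : ℝ)

/-! ### Quasi-stable models -/

/-- The quasi-stable model of `Γ` in which exactly the edges in `S` are subdivided, each by one
exceptional vertex `Sum.inr e`. For `e ∉ S`, the edge `Sum.inl e` is `e` itself. For `e ∈ S`,
the edge `Sum.inl e` is the part of `e` from its source to the exceptional vertex and
`Sum.inr e` is the part from the exceptional vertex to its target. -/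
def subdivide [DecidableEq E] (S : Finset E) :
    Multigraph (V ⊕ {e // e ∈ S}) (E ⊕ {e // e ∈ S}) where
  src := Sum.elim (fun e => Sum.inl (Γ.src e)) (fun x => Sum.inr x)
  tgt := Sum.elim (fun e => if h : e ∈ S then Sum.inr ⟨e, h⟩ else Sum.inl (Γ.tgt e))
    (fun x => Sum.inl (Γ.tgt x.1))

/-- Extension of a function on the vertices of `Γ` to a quasi-stable model, by zero on exceptional
vertices. -/
def extendZero {S : Finset E} {A : Type*} [Zero A] (f : V → A) : V ⊕ {e // e ∈ S} → A :=
  Sum.elim f (fun _ => 0)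

/-- The valence of a vertex subset: the number of edges joining it to its complement. -/
def valence [Fintype E] [DecidableEq V] (G : Finset V) : ℕ :=
  (Finset.univ.filter fun e => ¬ (Γ.src e ∈ G ↔ Γ.tgt e ∈ G)).card

/-- A set of vertices of a quasi-stable model all of whose members are exceptional. -/
def AllExceptional {S : Finset E} (G : Finset (V ⊕ {e // e ∈ S})) : Prop :=
  ∀ v ∈ G, v.isRight

/-- Admissible divisors on a quasi-stable model: degree one at every exceptional vertex. -/
def IsAdmissible {S : Finset E} (D : V ⊕ {e // e ∈ S} → ℤ) : Prop :=
  ∀ x, D (Sum.inr x) = 1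

section Stability

variable [Fintype V] [DecidableEq V] [Fintype E] [DecidableEq E]

/-- `θ`-semistability of an admissible divisor `D` on the quasi-stable model given by `S`. -/
def IsSemistable (θ : V → ℝ) (S : Finset E) (D : V ⊕ {e // e ∈ S} → ℤ) : Prop :=
  IsAdmissible D ∧ ∀ G : Finset (V ⊕ {e // e ∈ S}),
    (∑ v ∈ G, extendZero θ v) - ((Γ.subdivide S).valence G : ℝ) / 2 ≤ ((∑ v ∈ G, D v : ℤ) : ℝ) ∧
    ((∑ v ∈ G, D v : ℤ) : ℝ) ≤ (∑ v ∈ G, extendZero θ v) + ((Γ.subdivide S).valence G : ℝ) / 2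

/-- `θ`-stability: the inequalities are strict except possibly when the vertex set or its
complement consists of exceptional vertices. -/
def IsStable (θ : V → ℝ) (S : Finset E) (D : V ⊕ {e // e ∈ S} → ℤ) : Prop :=
  Γ.IsSemistable θ S D ∧ ∀ G : Finset (V ⊕ {e // e ∈ S}),
    ¬ AllExceptional G → ¬ AllExceptional Gᶜ →
    (∑ v ∈ G, extendZero θ v) - ((Γ.subdivide S).valence G : ℝ) / 2 < ((∑ v ∈ G, D v : ℤ) : ℝ) ∧
    ((∑ v ∈ G, D v : ℤ) : ℝ) < (∑ v ∈ G, extendZero θ v) + ((Γ.subdivide S).valence G : ℝ) / 2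

/-- `θ` is nondegenerate on `Γ` if, on every quasi-stable model of `Γ`, every semistable admissible
divisor is stable. -/
def IsNondegenerate (θ : V → ℝ) : Prop :=
  ∀ (S : Finset E) (D : V ⊕ {e // e ∈ S} → ℤ), Γ.IsSemistable θ S D → Γ.IsStable θ S D

/-- The triples `(Γ', D, I)`: `Γ'` is the quasi-stable model of `Γ` given by `S`, `D` is a
`θ`-stable divisor on it, and `I` is an acyclic flow on it with `div I = δ - D`, where the divisor
`δ` on `Γ` is extended by zero to the exceptional vertices. -/
structure IsTriple (θ : V → ℝ) (δ : V → ℤ) (S : Finset E) (D : V ⊕ {e // e ∈ S} → ℤ)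
    (I : GraphFlow (E ⊕ {e // e ∈ S})) : Prop where
  stable : Γ.IsStable θ S D
  acyclic : (Γ.subdivide S).IsAcyclic I
  div_eq : (Γ.subdivide S).div I = extendZero δ - D

end Stability

/-! ### Cones of edge lengths -/

/-- The orthant of nonnegative functions on a set. -/
def orthant (X : Type*) : PointedCone ℝ (X → ℝ) := PointedCone.positive ℝ (X → ℝ)

/-- From edge lengths on the quasi-stable model given by `S` to edge lengths on `Γ`:
the length of a subdivided edge is the sum of the lengths of its two parts. -/
def prLen [DecidableEq E] (S : Finset E) : (E ⊕ {e // e ∈ S} → ℝ) →ₗ[ℝ] (E → ℝ) where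
  toFun len e := len (Sum.inl e) + if h : e ∈ S then len (Sum.inr ⟨e, h⟩) else 0
  map_add' x y := by
    funext e
    by_cases h : e ∈ S <;> simp [h]
    ring
  map_smul' c x := by
    funext e
    by_cases h : e ∈ S <;> simp [h]
    ring

section Cones

variable [Fintype E] [DecidableEq V] [DecidableEq E]

/-- The cone of all nonnegative edge lengths on the quasi-stable model given by `S` for which the
flow `I` pairs to zero with first homology. -/
def tauOrthant (S : Finset E) (I : GraphFlow (E ⊕ {e // e ∈ S})) :
    PointedCone ℝ (E ⊕ {e // e ∈ S} → ℝ) where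
  carrier := {len | len ∈ orthant (E ⊕ {e // e ∈ S}) ∧
    ∀ γ ∈ (Γ.subdivide S).H1, GraphFlow.pairing len γ I = 0}
  zero_mem' := ⟨zero_mem _, fun γ _ => by simp [GraphFlow.pairing]⟩
  add_mem' {x y} hx hy := ⟨add_mem hx.1 hy.1, fun γ hγ => by
    have h1 := hx.2 γ hγ
    have h2 := hy.2 γ hγ
    simp only [GraphFlow.pairing, Pi.add_apply, add_mul, Finset.sum_add_distrib, mul_add] at *
    rw [h1, h2, add_zero]⟩
  smul_mem' c x hx := ⟨Submodule.smul_mem _ c hx.1, fun γ hγ => by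
    have h1 := hx.2 γ hγ
    have h2 : GraphFlow.pairing (c • x) γ I = (c : ℝ) * GraphFlow.pairing x γ I := by
      simp only [GraphFlow.pairing, Finset.mul_sum]
      refine Finset.sum_congr rfl fun a _ => ?_
      have h3 : (c • x) a.1 = (c : ℝ) * x a.1 := rfl
      rw [h3]
      ring
    rw [h2, h1, mul_zero]⟩

/-- The image `σ_{Γ', I}` of `tauOrthant` in the orthant of edge lengths on `Γ`. -/
def sigmaOrthant (S : Finset E) (I : GraphFlow (E ⊕ {e // e ∈ S})) : PointedCone ℝ (E → ℝ) :=
  (Γ.tauOrthant S I).map (prLen S)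

/-! ### Lengths in a monoid -/

variable {P : Type*} [AddCommMonoid P]

/-- The cone `Hom(P, ℝ≥0)` inside `Hom(P, ℝ)`. -/
def dualCone (P : Type*) [AddCommMonoid P] : PointedCone ℝ (P →+ ℝ) where
  carrier := {p | ∀ m, 0 ≤ p m}
  zero_mem' _ := le_rfl
  add_mem' hx hy m := add_nonneg (hx m) (hy m)
  smul_mem' c _ hx m := mul_nonneg c.2 (hx m)

/-- The cone `σ_{Γ'}` for the quasi-stable model `Γ'` given by `S`, when `Γ` is metrized by
`ℓ : E → P`: the fibre product of `Hom(P, ℝ≥0)` and the orthant of edge lengths on `Γ'` over the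
edge lengths on `Γ`. -/
def sigmaHat (ℓ : E → P) (S : Finset E) :
    PointedCone ℝ ((P →+ ℝ) × (E ⊕ {e // e ∈ S} → ℝ)) where
  carrier := {x | x.1 ∈ dualCone P ∧ x.2 ∈ orthant (E ⊕ {e // e ∈ S}) ∧
    prLen S x.2 = fun e => x.1 (ℓ e)}
  zero_mem' := ⟨zero_mem _, zero_mem _, by rw [Prod.snd_zero, map_zero]; rfl⟩
  add_mem' {x y} hx hy := ⟨add_mem hx.1 hy.1, add_mem hx.2.1 hy.2.1, by
    rw [Prod.snd_add, map_add, hx.2.2, hy.2.2]; rfl⟩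
  smul_mem' c x hx := ⟨Submodule.smul_mem _ c hx.1, Submodule.smul_mem _ c hx.2.1, by
    have h : prLen S (c • x).2 = (c : ℝ) • prLen S x.2 := (prLen S).map_smul (c : ℝ) x.2
    rw [h, hx.2.2]; rfl⟩

/-- The subcone `τ_{Γ', I}` of `σ_{Γ'}` on which `I` pairs to zero with first homology. -/
def tau (ℓ : E → P) (S : Finset E) (I : GraphFlow (E ⊕ {e // e ∈ S})) :
    PointedCone ℝ ((P →+ ℝ) × (E ⊕ {e // e ∈ S} → ℝ)) :=
  sigmaHat ℓ S ⊓ (Γ.tauOrthant S I).comap (LinearMap.snd ℝ (P →+ ℝ) _)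

/-- The image `σ_{Γ', I}` of `τ_{Γ', I}` under the projection to `Hom(P, ℝ≥0)`. -/
def sigma (ℓ : E → P) (S : Finset E) (I : GraphFlow (E ⊕ {e // e ∈ S})) : PointedCone ℝ (P →+ ℝ) :=
  (Γ.tau ℓ S I).map (LinearMap.fst ℝ (P →+ ℝ) _)

end Cones

end Multigraph

/-! ### Integral structures, isomorphisms of cones, fans -/

/-- The lattice of integral points of `ℝ^X`. -/
def latticeFun (X : Type*) : AddSubgroup (X → ℝ) where
  carrier := {p | ∀ x, ∃ z : ℤ, p x = z}
  zero_mem' _ := ⟨0, by simp⟩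
  add_mem' {p q} hp hq x := by
    obtain ⟨a, ha⟩ := hp x
    obtain ⟨b, hb⟩ := hq x
    exact ⟨a + b, by simp [ha, hb]⟩
  neg_mem' {p} hp x := by
    obtain ⟨a, ha⟩ := hp x
    exact ⟨-a, by simp [ha]⟩

/-- The lattice `Hom(P, ℤ)` in `Hom(P, ℝ)`. -/
def latticeHom (P : Type*) [AddCommMonoid P] : AddSubgroup (P →+ ℝ) where
  carrier := {p | ∀ m, ∃ z : ℤ, p m = z}
  zero_mem' _ := ⟨0, by simp⟩
  add_mem' {p q} hp hq m := by
    obtain ⟨a, ha⟩ := hp m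
    obtain ⟨b, hb⟩ := hq m
    exact ⟨a + b, by simp [ha, hb]⟩
  neg_mem' {p} hp m := by
    obtain ⟨a, ha⟩ := hp m
    exact ⟨-a, by simp [ha]⟩

section Fans

variable {N N' : Type*} [AddCommGroup N] [Module ℝ N] [AddCommGroup N'] [Module ℝ N']

/-- The linear map `f` restricts to an isomorphism from the cone `C` to the cone `C'`, compatible
with the integral structures given by the lattices `L` and `L'`: there is a linear map inverse to
`f` on the cones, and both maps preserve integral points. -/
def IsConeIso (L : AddSubgroup N) (L' : AddSubgroup N') (f : N →ₗ[ℝ] N')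
    (C : PointedCone ℝ N) (C' : PointedCone ℝ N') : Prop :=
  (∀ x ∈ C, f x ∈ C') ∧ (∀ x ∈ C, x ∈ L → f x ∈ L') ∧
  ∃ g : N' →ₗ[ℝ] N, (∀ y ∈ C', g y ∈ C) ∧ (∀ y ∈ C', y ∈ L' → g y ∈ L) ∧
    (∀ x ∈ C, g (f x) = x) ∧ (∀ y ∈ C', f (g y) = y)

/-- A (finite) fan of strongly convex rational polyhedral cones with respect to the lattice `L`. -/
structure IsFan (L : AddSubgroup N) (F : Set (PointedCone ℝ N)) : Prop where
  finite : F.Finite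
  rational_polyhedral : ∀ C ∈ F, ∃ t : Finset N, (t : Set N) ⊆ L ∧ C = PointedCone.hull ℝ (t : Set N)
  strongly_convex : ∀ C ∈ F, ∀ x ∈ C, -x ∈ C → x = 0
  face_mem : ∀ C ∈ F, ∀ C' : PointedCone ℝ N, C'.IsFaceOf C → C' ∈ F
  inter_face : ∀ C₁ ∈ F, ∀ C₂ ∈ F, (C₁ ⊓ C₂).IsFaceOf C₁ ∧ (C₁ ⊓ C₂).IsFaceOf C₂

/-- A collection of cones together with all their faces (each cone is a face of itself). -/
def withFaces (K : Set (PointedCone ℝ N)) : Set (PointedCone ℝ N) :=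
  {C | ∃ C₀ ∈ K, C.IsFaceOf C₀}

/-- The support of a collection of cones. -/
def fanSupport (F : Set (PointedCone ℝ N)) : Set N := {x | ∃ C ∈ F, x ∈ C}

end Fans

/-! ### Monoids and stable graphs -/

/-- Sharp fine and saturated (commutative) monoids. -/
structure IsSharpFs (P : Type*) [AddCommMonoid P] : Prop where
  fg : AddMonoid.FG P
  cancel : ∀ a b c : P, a + b = a + c → b = c
  saturated : ∀ (n : ℕ) (a b c : P), 0 < n → n • a = n • b + c → ∃ c', a = b + c'
  sharp : ∀ a b : P, a + b = 0 → a = 0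

namespace Multigraph

variable {V E : Type*} [Fintype V] [DecidableEq V] [Fintype E] (Γ : Multigraph V E)

/-- `n(v)`: the number of half-edges and legs at `v` (a loop contributes two half-edges). -/
def numHalfEdges {n : ℕ} (leg : Fin n → V) (v : V) : ℕ :=
  (Finset.univ.filter fun a : E × Bool => Γ.head a = v).card +
    (Finset.univ.filter fun i => leg i = v).card

/-- `Γ` with the vertex genera `gen` and the legs `leg` is a stable graph of type `(g, n)`. -/
structure IsStableGraph (g n : ℕ) (gen : V → ℕ) (leg : Fin n → V) : Prop where
  connected : Γ.Connected
  genus_eq : (∑ v, gen v) + Fintype.card E + 1 = g + Fintype.card V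
  stable : ∀ v, 0 < 2 * (gen v : ℤ) - 2 + Γ.numHalfEdges leg v

/-- The multidegree of the `k`-th power of the log canonical bundle twisted down by
`∑ i, A i • x_i`. -/
def degKA {n : ℕ} (gen : V → ℕ) (leg : Fin n → V) (k : ℤ) (A : Fin n → ℤ) : V → ℤ :=
  fun v => k * (2 * (gen v : ℤ) - 2 + Γ.numHalfEdges leg v) - ∑ i with leg i = v, A i

end Multigraph

/-! The cones are spaces of piecewise linear potentials. At an exceptional vertex `D` is 1 and `δ`
is 0, so `I` jumps by one there. Orthogonality of `I` to the first homology therefore means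
(`mem_sigmaOrthant_iff`) that there is a potential on `V` which rises along each edge `e` with slope
`I e`, followed, if `e` is subdivided, by slope `I e + 1` on a final piece of length `t e`.
Stability of `D`, read for vertex sets `G ⊆ V`, becomes a strict upper bound for the flow into `G`,
with a correction of `1/2` per cut edge (`IsTriple.sum_cutTerm_lt`). Adding such bounds for `G` and
its complement is the basic move: the right-hand sides cancel because `θ` and `δ` have the same
total.

Isomorphism: on a cut consisting of subdivided edges only, the left-hand sides would cancel too, so
the unsubdivided edges connect `Γ` (`IsTriple.eqvGen`). Potential differences, and hence the lengths
`t e`, are then integral linear functions of the edge lengths of `Γ`, which gives an integral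
inverse (`IsTriple.exists_section`).

Fan: if two triples have potentials `φ` and `φ'` on the same lengths, the set where `φ - φ'` is
maximal is a cut violating stability unless it is everything (`IsTriple.potential_sub_eq`).
Potentials being unique up to constants, comparing them edge by edge shows that `x, y ∈ σ` and `x +
y ∈ σ'` imply `x ∈ σ'`, so that intersections are faces. There are finitely many cones because an
acyclic flow is bounded by its divisor (`IsAcyclic.abs_le`).

Support: for positive lengths, minimize a convex energy whose density is the piecewise affine
interpolation of half the square at the integers, with linear term `δ - θ`. The one-sided
derivatives in the directions of vertex sets are the cut inequalities for the flow obtained by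
rounding the slopes (`Connected.exists_potential`). The resulting divisor is semistable, hence
stable by nondegeneracy. Zero lengths follow by taking limits, since the finitely many cones are
closed.

Over a monoid `P`, each cone is the part of `Hom(P, ℝ≥0)` lying over the corresponding cone of edge
lengths (`mem_sigma_iff`), so all but rationality is inherited. Rationality comes from
Fourier–Motzkin elimination in coordinates given by generators of `P`. -/

/-! ### Rational polyhedral cones -/

section RationalCones

variable {N N' : Type*} [AddCommGroup N] [Module ℝ N] [AddCommGroup N'] [Module ℝ N']

/-- The cone `C` is generated by finitely many points of the lattice `L`. -/
def IsRationalPolyhedral (L : AddSubgroup N) (C : PointedCone ℝ N) : Prop :=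
  ∃ t : Finset N, (t : Set N) ⊆ L ∧ C = PointedCone.hull ℝ (t : Set N)

theorem PointedCone.mem_hull_finset {t : Finset N} {x : N} :
    x ∈ PointedCone.hull ℝ (t : Set N) ↔
      ∃ c : N → ℝ, (∀ a, 0 ≤ c a) ∧ ∑ a ∈ t, c a • a = x := by
  constructor
  · intro hx
    obtain ⟨f, -, hf⟩ := Submodule.mem_span_finset.1 hx
    exact ⟨fun a => f a, fun a => (f a).2, hf⟩
  · rintro ⟨c, hc, rfl⟩
    exact sum_mem fun a ha => PointedCone.smul_mem _ (hc a) (PointedCone.subset_hull ha)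

theorem PointedCone.map_hull (f : N →ₗ[ℝ] N') (s : Set N) :
    (PointedCone.hull ℝ s).map f = PointedCone.hull ℝ (f '' s) :=
  Submodule.map_span _ s

theorem IsRationalPolyhedral.map {L : AddSubgroup N} {L' : AddSubgroup N'} {C : PointedCone ℝ N}
    (hC : IsRationalPolyhedral L C) (f : N →ₗ[ℝ] N') (hf : ∀ x ∈ L, f x ∈ L') :
    IsRationalPolyhedral L' (C.map f) := by
  classical
  obtain ⟨t, ht, rfl⟩ := hC
  refine ⟨t.image f, ?_, ?_⟩
  · rw [Finset.coe_image]
    rintro _ ⟨x, hx, rfl⟩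
    exact hf x (ht hx)
  · rw [PointedCone.map_hull, Finset.coe_image]

/-- A face of a finitely generated cone is generated by the generators that it contains. -/
theorem PointedCone.IsFaceOf.eq_hull_filter {t : Finset N} {F : PointedCone ℝ N}
    [DecidablePred (· ∈ F)] (hF : F.IsFaceOf (PointedCone.hull ℝ (t : Set N))) :
    F = PointedCone.hull ℝ ((t.filter (· ∈ F) : Finset N) : Set N) := by
  apply le_antisymm
  · intro x hx
    obtain ⟨c, hc, rfl⟩ := PointedCone.mem_hull_finset.1 (hF.le hx)
    refine sum_mem fun a ha => ?_
    rcases (hc a).eq_or_lt with h0 | h0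
    · rw [← h0, zero_smul]
      exact zero_mem _
    · refine PointedCone.smul_mem _ h0.le (PointedCone.subset_hull ?_)
      rw [Finset.coe_filter]
      refine ⟨ha, ?_⟩
      classical
      -- The element of `F` is a positive multiple of `a` plus another element of the cone, so the
      -- face property puts `a` in `F`.
      refine hF.mem_of_smul_add_mem (y := ∑ b ∈ t.erase a, c b • b)
        (PointedCone.subset_hull ha) ?_ h0 ?_
      · exact sum_mem fun b hb => PointedCone.smul_mem _ (hc b)
          (PointedCone.subset_hull (Finset.mem_of_mem_erase hb))
      · rwa [Finset.add_sum_erase t (fun b => c b • b) ha]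
  · refine Submodule.span_le.2 fun a ha => ?_
    exact (Finset.mem_filter.1 ha).2

theorem IsRationalPolyhedral.face {L : AddSubgroup N} {C F : PointedCone ℝ N}
    (hC : IsRationalPolyhedral L C) (hF : F.IsFaceOf C) : IsRationalPolyhedral L F := by
  classical
  obtain ⟨t, ht, rfl⟩ := hC
  exact ⟨_, fun x hx => ht (Finset.mem_filter.1 hx).1, hF.eq_hull_filter⟩

theorem IsRationalPolyhedral.finite_faces {L : AddSubgroup N} {C : PointedCone ℝ N}
    (hC : IsRationalPolyhedral L C) : {F : PointedCone ℝ N | F.IsFaceOf C}.Finite := by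
  classical
  obtain ⟨t, -, rfl⟩ := hC
  refine (t.powerset.finite_toSet.image fun s : Finset N => PointedCone.hull ℝ (s : Set N)).subset ?_
  intro F hF
  exact ⟨t.filter (· ∈ F), Finset.mem_coe.2 (Finset.mem_powerset.2 (Finset.filter_subset _ _)), (PointedCone.IsFaceOf.eq_hull_filter hF).symm⟩

theorem Finset.sum_eq_sum_sign_filter {α M : Type*} [AddCommMonoid M] (t : Finset α) (φ : α → ℝ)
    (f : α → M) : ∑ a ∈ t, f a = ∑ a ∈ t with φ a = 0, f a +
      (∑ a ∈ t with 0 < φ a, f a + ∑ a ∈ t with φ a < 0, f a) := by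
  simp only [Finset.sum_filter, ← Finset.sum_add_distrib]
  refine Finset.sum_congr rfl fun a _ => ?_
  rcases lt_trichotomy (φ a) 0 with h | h | h
  · simp [h, h.ne, h.not_gt]
  · simp [h]
  · simp [h, h.ne', h.not_gt]

/-- One step of Fourier–Motzkin elimination. -/
theorem IsRationalPolyhedral.inf_ker {L : AddSubgroup N} {C : PointedCone ℝ N}
    (hC : IsRationalPolyhedral L C) (φ : N →ₗ[ℝ] ℝ) (hφ : ∀ x ∈ L, ∃ z : ℤ, φ x = z) :
    IsRationalPolyhedral L (C ⊓ PointedCone.ofSubmodule (LinearMap.ker φ)) := by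
  classical
  obtain ⟨t, ht, rfl⟩ := hC
  set t0 := t.filter fun a => φ a = 0
  set tp := t.filter fun a => 0 < φ a
  set tn := t.filter fun a => φ a < 0
  -- New generators: those already in the kernel, and for each pair with `φ a > 0 > φ b` the
  -- positive combination on which `φ` cancels. As `φ` is integral on `L`, this combination stays in
  -- `L`.
  set u : Finset N := t0 ∪ (tp ×ˢ tn).image fun p => φ p.1 • p.2 - φ p.2 • p.1
  have hpn : ∀ a ∈ tp, ∀ b ∈ tn, φ a • b - φ b • a ∈ u := fun a ha b hb =>
    Finset.mem_union_right _ (Finset.mem_image.2 ⟨(a, b), Finset.mem_product.2 ⟨ha, hb⟩, rfl⟩)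
  have hu : ∀ x ∈ u, x ∈ t0 ∨ ∃ a ∈ tp, ∃ b ∈ tn, φ a • b - φ b • a = x := by
    intro x hx
    rcases Finset.mem_union.1 hx with h | h
    · exact Or.inl h
    · obtain ⟨p, hp, rfl⟩ := Finset.mem_image.1 h
      obtain ⟨h1, h2⟩ := Finset.mem_product.1 hp
      exact Or.inr ⟨_, h1, _, h2, rfl⟩
  have hzsmul : ∀ a ∈ L, ∀ b ∈ L, φ a • b ∈ L := by
    intro a ha b hb
    obtain ⟨z, hz⟩ := hφ a ha
    rw [hz, Int.cast_smul_eq_zsmul]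
    exact zsmul_mem hb z
  refine ⟨u, ?_, le_antisymm ?_ ?_⟩
  · intro x hx
    rcases hu x hx with h | ⟨a, ha, b, hb, rfl⟩
    · exact ht (Finset.mem_filter.1 h).1
    · have ha' := ht (Finset.mem_filter.1 ha).1
      have hb' := ht (Finset.mem_filter.1 hb).1
      exact sub_mem (hzsmul _ ha' _ hb') (hzsmul _ hb' _ ha')
  · rintro x ⟨hx, hxφ⟩
    obtain ⟨c, hc, rfl⟩ := PointedCone.mem_hull_finset.1 hx
    have hker : ∑ a ∈ t, c a * φ a = 0 := by
      have h : φ (∑ a ∈ t, c a • a) = 0 := hxφ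
      simpa [map_sum] using h
    have h0 : ∑ a ∈ t0, c a * φ a = 0 :=
      Finset.sum_eq_zero fun a ha => by rw [(Finset.mem_filter.1 ha).2, mul_zero]
    rw [Finset.sum_eq_sum_sign_filter t φ, h0, zero_add] at hker
    have hp0 : ∀ a ∈ tp, 0 ≤ c a * φ a := fun a ha =>
      mul_nonneg (hc a) (Finset.mem_filter.1 ha).2.le
    have hn0 : ∀ a ∈ tn, c a * φ a ≤ 0 := fun a ha =>
      mul_nonpos_of_nonneg_of_nonpos (hc a) (Finset.mem_filter.1 ha).2.le
    rw [Finset.sum_eq_sum_sign_filter t φ]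
    refine add_mem (sum_mem fun a ha => PointedCone.smul_mem _ (hc a)
      (PointedCone.subset_hull (Finset.mem_union_left _ ha))) ?_
    set s := ∑ a ∈ tp, c a * φ a
    rcases (Finset.sum_nonneg hp0 : 0 ≤ s).eq_or_lt with hs | hs
    · have hp1 : ∀ a ∈ tp, c a = 0 := fun a ha => by
        have := (Finset.sum_eq_zero_iff_of_nonneg hp0).1 hs.symm a ha
        exact (mul_eq_zero.1 this).resolve_right (Finset.mem_filter.1 ha).2.ne'
      have hn1 : ∀ a ∈ tn, c a = 0 := fun a ha => by
        have h2 : ∑ a ∈ tn, c a * φ a = 0 := by linarith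
        have := (Finset.sum_eq_zero_iff_of_nonpos hn0).1 h2 a ha
        exact (mul_eq_zero.1 this).resolve_right (Finset.mem_filter.1 ha).2.ne
      rw [Finset.sum_eq_zero fun a ha => by rw [hp1 a ha, zero_smul],
        Finset.sum_eq_zero fun a ha => by rw [hn1 a ha, zero_smul], add_zero]
      exact zero_mem _
    · have hsn : ∑ a ∈ tn, c a * φ a = -s := by linarith
      -- Each pair is weighted by `c a * c b / s`. Summing over one index recovers the original
      -- coefficient of the other, since the positive and negative parts of `φ` total `s` and `-s`.
      have key : ∑ a ∈ tp, c a • a + ∑ a ∈ tn, c a • a =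
          ∑ a ∈ tp, ∑ b ∈ tn, (s⁻¹ * c a * c b) • (φ a • b - φ b • a) := by
        have e1 : ∑ a ∈ tp, ∑ b ∈ tn, (s⁻¹ * c a * c b) • (φ a • b) = ∑ b ∈ tn, c b • b := by
          rw [Finset.sum_comm]
          refine Finset.sum_congr rfl fun b _ => ?_
          rw [show ∑ a ∈ tp, (s⁻¹ * c a * c b) • (φ a • b) = (s⁻¹ * s * c b) • b by
            simp only [s, Finset.mul_sum, Finset.sum_mul, Finset.sum_smul, smul_smul]
            exact Finset.sum_congr rfl fun a _ => by ring_nf]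
          rw [inv_mul_cancel₀ hs.ne', one_mul]
        have e2 : ∑ a ∈ tp, ∑ b ∈ tn, (s⁻¹ * c a * c b) • (φ b • a) = -∑ a ∈ tp, c a • a := by
          rw [← Finset.sum_neg_distrib]
          refine Finset.sum_congr rfl fun a _ => ?_
          rw [show ∑ b ∈ tn, (s⁻¹ * c a * c b) • (φ b • a) =
              (s⁻¹ * c a * ∑ b ∈ tn, c b * φ b) • a by
            simp only [Finset.mul_sum, Finset.sum_smul, smul_smul]
            exact Finset.sum_congr rfl fun b _ => by ring_nf]
          rw [hsn, ← neg_smul]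
          congr 1
          have hs' : s ≠ 0 := hs.ne'
          field_simp
        simp only [smul_sub, Finset.sum_sub_distrib, e1, e2]
        abel
      rw [key]
      refine sum_mem fun a ha => sum_mem fun b hb => PointedCone.smul_mem _ ?_
        (PointedCone.subset_hull (hpn a ha b hb))
      exact mul_nonneg (mul_nonneg (inv_nonneg.2 hs.le) (hc a)) (hc b)
  · refine Submodule.span_le.2 fun x hx => ?_
    rcases hu x hx with h | ⟨a, ha, b, hb, rfl⟩
    · exact ⟨PointedCone.subset_hull (Finset.mem_filter.1 h).1, (Finset.mem_filter.1 h).2⟩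
    · obtain ⟨ha1, ha2⟩ := Finset.mem_filter.1 ha
      obtain ⟨hb1, hb2⟩ := Finset.mem_filter.1 hb
      refine ⟨?_, ?_⟩
      · rw [sub_eq_add_neg, ← neg_smul]
        exact add_mem (PointedCone.smul_mem _ ha2.le (PointedCone.subset_hull hb1))
          (PointedCone.smul_mem _ (by linarith) (PointedCone.subset_hull ha1))
      · change φ _ = 0
        simp only [map_sub, map_smul, smul_eq_mul]
        ring

theorem Multigraph.mem_orthant {X : Type*} {x : X → ℝ} :
    x ∈ Multigraph.orthant X ↔ ∀ i, 0 ≤ x i := Iff.rfl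

theorem isRationalPolyhedral_orthant (X : Type*) [Fintype X] :
    IsRationalPolyhedral (latticeFun X) (Multigraph.orthant X) := by
  classical
  refine ⟨Finset.univ.image fun i => Pi.single i 1, ?_, le_antisymm ?_ ?_⟩
  · intro x hx
    obtain ⟨i, -, rfl⟩ := Finset.mem_image.1 hx
    intro j
    by_cases h : j = i
    · subst h
      exact ⟨1, by simp⟩
    · exact ⟨0, by simp [h]⟩
  · intro x hx
    have h : x = ∑ i, x i • (Pi.single i 1 : X → ℝ) := by
      funext j
      simp [Finset.sum_apply, Pi.single_apply]
    rw [h]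
    exact sum_mem fun i _ => PointedCone.smul_mem _ (hx i)
      (PointedCone.subset_hull (Finset.mem_image_of_mem _ (Finset.mem_univ i)))
  · refine Submodule.span_le.2 fun x hx => ?_
    obtain ⟨i, -, rfl⟩ := Finset.mem_image.1 hx
    exact Pi.single_nonneg.2 zero_le_one

/-- The linear functional on `ℝ^X` with the given integral coefficients. -/
noncomputable def intFunctional {X : Type*} [Fintype X] (a : X → ℤ) : (X → ℝ) →ₗ[ℝ] ℝ :=
  ∑ i, (a i : ℝ) • LinearMap.proj i

theorem intFunctional_apply {X : Type*} [Fintype X] (a : X → ℤ) (x : X → ℝ) :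
    intFunctional a x = ∑ i, (a i : ℝ) * x i := by
  simp [intFunctional, LinearMap.sum_apply]

theorem intFunctional_mem_latticeFun {X : Type*} [Fintype X] (a : X → ℤ) {x : X → ℝ}
    (hx : x ∈ latticeFun X) : ∃ z : ℤ, intFunctional a x = z := by
  choose z hz using hx
  exact ⟨∑ i, a i * z i, by simp [intFunctional_apply, hz]⟩

/-- The section of the orthant by a family of integral linear equations is rational polyhedral. -/
theorem isRationalPolyhedral_of_equations {X : Type*} [Fintype X] (A : Set (X → ℤ))
    {C : PointedCone ℝ (X → ℝ)}
    (hC : ∀ x, x ∈ C ↔ (∀ i, 0 ≤ x i) ∧ ∀ a ∈ A, ∑ i, (a i : ℝ) * x i = 0) :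
    IsRationalPolyhedral (latticeFun X) C := by
  classical
  -- The equations span a finitely generated subgroup of `ℤ^X`, so finitely many of them suffice and
  -- can be imposed one at a time.
  obtain ⟨B, hB⟩ := IsNoetherian.noetherian (Submodule.span ℤ A)
  have hfin : ∀ B : Finset (X → ℤ), ∃ D : PointedCone ℝ (X → ℝ),
      IsRationalPolyhedral (latticeFun X) D ∧
      ∀ x, x ∈ D ↔ (∀ i, 0 ≤ x i) ∧ ∀ a ∈ B, ∑ i, (a i : ℝ) * x i = 0 := by
    intro B
    induction B using Finset.induction_on with
    | empty => exact ⟨_, isRationalPolyhedral_orthant X, fun x => by simp [Multigraph.mem_orthant]⟩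
    | insert b B _ ih =>
      obtain ⟨D, hD, hD'⟩ := ih
      refine ⟨_, hD.inf_ker (intFunctional b) fun x hx => intFunctional_mem_latticeFun b hx,
        fun x => ?_⟩
      rw [Submodule.mem_inf, hD', PointedCone.mem_ofSubmodule_iff, LinearMap.mem_ker,
        intFunctional_apply, Finset.forall_mem_insert]
      tauto
  have hspan : ∀ (s : Set (X → ℤ)) (x : X → ℝ), (∀ a ∈ s, ∑ i, (a i : ℝ) * x i = 0) →
      ∀ a ∈ Submodule.span ℤ s, ∑ i, (a i : ℝ) * x i = 0 := by
    intro s x hx a ha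
    induction ha using Submodule.span_induction with
    | mem a ha => exact hx a ha
    | zero => simp
    | add a b _ _ ha hb => simp [add_mul, Finset.sum_add_distrib, ha, hb]
    | smul z a _ ha => simp [mul_assoc, ← Finset.mul_sum, ha]
  obtain ⟨D, hD, hD'⟩ := hfin B
  have : C = D := by
    ext x
    rw [hC, hD']
    refine and_congr_right fun _ => ⟨fun h a ha => ?_, fun h a ha => ?_⟩
    · exact hspan A x h a (hB ▸ Submodule.subset_span ha)
    · exact hspan B x h a (hB ▸ Submodule.subset_span ha)
  rwa [this]

/-! ### Fans from families of cones -/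

/-- A finite family of strongly convex rational polyhedral cones, any two of which meet in a
common face, forms a fan together with all faces. -/
theorem isFan_withFaces {L : AddSubgroup N} {K : Set (PointedCone ℝ N)} (hfin : K.Finite)
    (hrat : ∀ C ∈ K, IsRationalPolyhedral L C)
    (hconv : ∀ C ∈ K, ∀ x ∈ C, -x ∈ C → x = 0)
    (hface : ∀ C₁ ∈ K, ∀ C₂ ∈ K, ∀ x ∈ C₁, ∀ y ∈ C₁, x + y ∈ C₂ → x ∈ C₂) :
    IsFan L (withFaces K) where
  finite := by
    refine (hfin.biUnion fun C hC => (hrat C hC).finite_faces).subset ?_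
    rintro F ⟨C, hC, hF⟩
    exact Set.mem_biUnion hC hF
  rational_polyhedral := by
    rintro F ⟨C, hC, hF⟩
    exact (hrat C hC).face hF
  strongly_convex := by
    rintro F ⟨C, hC, hF⟩ x hx hx'
    exact hconv C hC x (hF.le hx) (hF.le hx')
  face_mem := by
    rintro F ⟨C, hC, hF⟩ F' hF'
    exact ⟨C, hC, hF'.trans hF⟩
  inter_face := by
    have main : ∀ F₁ ∈ withFaces K, ∀ F₂ ∈ withFaces K, (F₁ ⊓ F₂).IsFaceOf F₁ := by
      rintro F₁ ⟨C₁, hC₁, hF₁⟩ F₂ ⟨C₂, hC₂, hF₂⟩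
      refine PointedCone.IsFaceOf.of_mem_of_add_mem_left inf_le_left fun {x y} hx hy hxy => ?_
      -- The hypothesis on the big cones moves both summands into `C₂`; only then can the face
      -- property of `F₂` in `C₂` be used.
      have h1 : x ∈ C₂ := hface _ hC₁ _ hC₂ x (hF₁.le hx) y (hF₁.le hy) (hF₂.le hxy.2)
      have h2 : y ∈ C₂ := hface _ hC₁ _ hC₂ y (hF₁.le hy) x (hF₁.le hx)
        (by rw [add_comm]; exact hF₂.le hxy.2)
      exact ⟨hx, hF₂.mem_of_add_mem_left h1 h2 hxy.2⟩
    exact fun F₁ h₁ F₂ h₂ => ⟨main F₁ h₁ F₂ h₂, inf_comm F₁ F₂ ▸ main F₂ h₂ F₁ h₁⟩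

theorem fanSupport_withFaces (K : Set (PointedCone ℝ N)) :
    fanSupport (withFaces K) = {x | ∃ C ∈ K, x ∈ C} := by
  ext x
  constructor
  · rintro ⟨F, ⟨C, hC, hF⟩, hx⟩
    exact ⟨C, hC, hF.le hx⟩
  · rintro ⟨C, hC, hx⟩
    exact ⟨C, ⟨C, hC, PointedCone.IsFaceOf.refl C⟩, hx⟩

end RationalCones

/-! ### Potentials and acyclic flows -/

namespace Multigraph

variable {V E : Type*}

theorem sum_val_mul [Fintype E] {R : Type*} [CommRing R] (f : GraphFlow E) (u : E × Bool → R) :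
    ∑ a : E × Bool, (f.val a : R) * u a = ∑ e, (f e : R) * (u (e, true) - u (e, false)) := by
  rw [Fintype.sum_prod_type]
  refine Finset.sum_congr rfl fun e _ => ?_
  simp [GraphFlow.val]
  ring

theorem _root_.GraphFlow.pairing_eq_sum [Fintype E] (len : E → ℝ) (f g : GraphFlow E) :
    GraphFlow.pairing len f g = ∑ e, (f e : ℝ) * (len e * g e) := by
  rw [GraphFlow.pairing, Fintype.sum_prod_type, Finset.mul_sum]
  refine Finset.sum_congr rfl fun e _ => ?_
  simp [GraphFlow.val]
  ring

section Div

variable [Fintype E] [DecidableEq V] (Γ : Multigraph V E)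

theorem div_apply (f : GraphFlow E) (v : V) :
    Γ.div f v = ∑ e, f e * ((if Γ.tgt e = v then 1 else 0) - (if Γ.src e = v then 1 else 0)) := by
  change ∑ a : E × Bool with Γ.head a = v, f.val a = _
  rw [Finset.sum_filter]
  have h := sum_val_mul (R := ℤ) f fun a => if Γ.head a = v then 1 else 0
  simp only [mul_ite, mul_one, mul_zero, Int.cast_id] at h
  exact h

/-- Summation by parts: the divisor map is adjoint to the coboundary on vertex functions. -/
theorem sum_mul_div [Fintype V] {R : Type*} [CommRing R] (f : GraphFlow E) (u : V → R) :
    ∑ v, u v * (Γ.div f v : R) = ∑ e, (f e : R) * (u (Γ.tgt e) - u (Γ.src e)) := by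
  simp only [div_apply, Int.cast_sum, Finset.mul_sum]
  rw [Finset.sum_comm]
  refine Finset.sum_congr rfl fun e _ => ?_
  have h : ∀ v, u v * ((f e * ((if Γ.tgt e = v then 1 else 0) -
      (if Γ.src e = v then 1 else 0)) : ℤ) : R) =
      (f e : R) * ((if Γ.tgt e = v then u v else 0) - (if Γ.src e = v then u v else 0)) := by
    intro v
    push_cast
    split_ifs <;> ring
  simp only [h, ← Finset.mul_sum, Finset.sum_sub_distrib, Finset.sum_ite_eq, Finset.mem_univ,
    if_true]

theorem sum_div_finset [Fintype V] (f : GraphFlow E) (G : Finset V) :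
    ∑ v ∈ G, Γ.div f v =
      ∑ e, f e * ((if Γ.tgt e ∈ G then 1 else 0) - (if Γ.src e ∈ G then 1 else 0)) := by
  have h := Γ.sum_mul_div f fun v => if v ∈ G then (1 : ℤ) else 0
  simpa [Finset.sum_ite_mem] using h

theorem sum_div_sub_valence [Fintype V] (f : GraphFlow E) (G : Finset V) :
    ((∑ v ∈ G, Γ.div f v : ℤ) : ℝ) - (Γ.valence G : ℝ) / 2 =
      ∑ e, ((f e : ℝ) * ((if Γ.tgt e ∈ G then 1 else 0) - (if Γ.src e ∈ G then 1 else 0)) -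
        if (Γ.src e ∈ G ↔ Γ.tgt e ∈ G) then 0 else 1 / 2) := by
  rw [sum_div_finset, valence, Finset.sum_sub_distrib, Finset.card_filter]
  push_cast
  rw [Finset.sum_div]
  congr 1
  refine Finset.sum_congr rfl fun e _ => ?_
  split_ifs <;> simp_all

/-- In a connected graph, any two vertices are joined by an integral unit flow. -/
theorem exists_flow_of_eqvGen (u v : V)
    (h : Relation.EqvGen (fun x y => ∃ e, Γ.src e = x ∧ Γ.tgt e = y) u v) :
    ∃ f : GraphFlow E, Γ.div f = Pi.single v 1 - Pi.single u 1 := by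
  classical
  induction h with
  | rel x y h =>
    obtain ⟨e, rfl, rfl⟩ := h
    refine ⟨Pi.single e 1, ?_⟩
    funext w
    rw [div_apply, Finset.sum_eq_single e (fun b _ hb => by simp [hb]) (by simp)]
    simp [Pi.single_apply, eq_comm]
  | refl x => exact ⟨0, by simp⟩
  | symm x y _ ih =>
    obtain ⟨f, hf⟩ := ih
    exact ⟨-f, by rw [map_neg, hf, neg_sub]⟩
  | trans x y z _ _ ih1 ih2 =>
    obtain ⟨f, hf⟩ := ih1
    obtain ⟨g, hg⟩ := ih2
    exact ⟨f + g, by rw [map_add, hf, hg]; abel⟩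

/-- On a connected graph, a flow is orthogonal to the first homology if and only if, weighted by
the lengths, it is the coboundary of a potential. -/
theorem pairing_eq_zero_iff [Fintype V] (hΓ : Γ.Connected) (len : E → ℝ) (I : GraphFlow E) :
    (∀ γ ∈ Γ.H1, GraphFlow.pairing len γ I = 0) ↔
      ∃ φ : V → ℝ, ∀ e, φ (Γ.tgt e) - φ (Γ.src e) = len e * I e := by
  classical
  constructor
  · intro h
    obtain ⟨⟨v₀⟩, hconn⟩ := hΓ
    choose p hp using fun v => Γ.exists_flow_of_eqvGen v₀ v (hconn v₀ v)
    -- The potential at `v` integrates `I`, weighted by length, along a unit flow from `v₀` to `v`.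
    -- Two such flows together with the edge `e` close up to a homology class.
    refine ⟨fun v => GraphFlow.pairing len (p v) I, fun e => ?_⟩
    obtain ⟨s, hs⟩ := Γ.exists_flow_of_eqvGen (Γ.src e) (Γ.tgt e) (.rel _ _ ⟨e, rfl, rfl⟩)
    have hsingle : Γ.div (Pi.single e 1) = Pi.single (Γ.tgt e) 1 - Pi.single (Γ.src e) 1 := by
      funext w
      rw [div_apply, Finset.sum_eq_single e (fun b _ hb => by simp [hb]) (by simp)]
      simp [Pi.single_apply, eq_comm]
    have hker : Pi.single e 1 + p (Γ.src e) - p (Γ.tgt e) ∈ Γ.H1 := by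
      rw [H1, AddMonoidHom.mem_ker, map_sub, map_add, hp, hp, hsingle]
      abel
    have h0 := h _ hker
    simp only [GraphFlow.pairing_eq_sum, Pi.sub_apply, Pi.add_apply, Int.cast_sub, Int.cast_add,
      sub_mul, add_mul, Finset.sum_sub_distrib, Finset.sum_add_distrib] at h0 ⊢
    rw [Finset.sum_eq_single e (fun b _ hb => by simp [hb]) (by simp)] at h0
    simp only [Pi.single_eq_same, Int.cast_one, one_mul] at h0
    linarith
  · rintro ⟨φ, hφ⟩ γ hγ
    rw [GraphFlow.pairing_eq_sum]
    simp only [← hφ]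
    rw [← Γ.sum_mul_div γ φ]
    refine Finset.sum_eq_zero fun v _ => ?_
    rw [(hγ : Γ.div γ = 0)]
    simp

end Div

section Acyclic

variable (Γ : Multigraph V E)

/-- If positive steps lead from `v` to `w`, a positive oriented edge ending at `v` extends to a path
of positive oriented edges ending at `w`. -/
theorem exists_positive_path {f : GraphFlow E} {v w : V}
    (h : Relation.ReflTransGen (fun x y => ∃ b, Γ.tail b = x ∧ Γ.head b = y ∧ 0 < f.val b) v w)
    (a : E × Bool) (ha : Γ.head a = v) (hpos : 0 < f.val a) :
    ∃ (m : ℕ) (c : ℕ → E × Bool), c 0 = a ∧ (∀ i ≤ m, 0 < f.val (c i)) ∧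
      (∀ i < m, Γ.head (c i) = Γ.tail (c (i + 1))) ∧ Γ.head (c m) = w := by
  induction h with
  | refl => exact ⟨0, fun _ => a, rfl, fun _ _ => hpos, by simp, ha⟩
  | tail _ hstep ih =>
    obtain ⟨m, c, h0, hp, hc, hm⟩ := ih
    obtain ⟨b, hb1, hb2, hb3⟩ := hstep
    refine ⟨m + 1, Function.update c (m + 1) b, by simp [h0], fun i hi => ?_, fun i hi => ?_,
      by simp [hb2]⟩
    · rcases hi.eq_or_lt with rfl | hi
      · simpa using hb3
      · rw [Function.update_of_ne hi.ne]
        exact hp i (by omega)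
    · rw [Function.update_of_ne hi.ne]
      by_cases him : i = m
      · subst him
        simp [hm, hb1]
      · rw [Function.update_of_ne (by omega)]
        exact hc i (by omega)

/-- A closed walk with positive flow contains a cycle with positive flow. -/
theorem not_isAcyclic_of_closed {f : GraphFlow E}
    (h : ∃ (m : ℕ) (c : ℕ → E × Bool), (∀ i ≤ m, 0 < f.val (c i)) ∧
      (∀ i < m, Γ.head (c i) = Γ.tail (c (i + 1))) ∧ Γ.head (c m) = Γ.tail (c 0)) :
    ¬ Γ.IsAcyclic f := by
  classical
  obtain ⟨c, hp, hc, hm⟩ := Nat.find_spec h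
  set m := Nat.find h
  have hinj : ∀ i j, i < j → j ≤ m → Γ.tail (c i) ≠ Γ.tail (c j) := by
    intro i j hij hj heq
    -- In a closed walk of minimal length, a repeated tail would cut off a shorter closed walk,
    -- namely the steps `i, …, j - 1`.
    refine Nat.find_min h (m := j - i - 1) (by omega)
      ⟨fun k => c (i + k), fun k hk => hp _ (by omega), fun k hk => ?_, ?_⟩
    · rw [hc _ (by omega), add_assoc]
    · rw [hc _ (by omega), show i + (j - i - 1) + 1 = j by omega, ← heq]
      rfl
  have htail : Function.Injective fun i : Fin (m + 1) => Γ.tail (c i) := by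
    intro i j hij
    by_contra hne
    rcases lt_or_gt_of_ne (Fin.val_ne_of_ne hne) with hlt | hlt
    · exact hinj i j hlt (by omega) hij
    · exact hinj j i hlt (by omega) hij.symm
  refine fun hacyc => hacyc ⟨m, fun i => c i, ⟨fun i => ?_, htail, fun i j hij => ?_⟩,
    fun i => (hp i (by omega)).le, 0, hp _ (by omega)⟩
  · by_cases hi : i = Fin.last m
    · subst hi
      simpa using hm
    · have h1 := hc i (Fin.val_lt_last hi)
      rwa [← Fin.val_add_one_of_lt (Fin.lt_last_iff_ne_last.2 hi)] at h1
  · have hi := hp i (by omega)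
    have hj := hp j (by omega)
    apply htail
    -- A repeated edge must occur with the same orientation, since its two orientations cannot both
    -- carry positive flow.
    have : c i = c j := by
      refine Prod.ext hij ?_
      simp only at hij
      simp only [GraphFlow.val, hij] at hi hj
      cases hci : (c i).2 <;> cases hcj : (c j).2 <;> simp_all <;> omega
    simp only [this]

/-- An acyclic flow is bounded by its divisor. -/
theorem IsAcyclic.abs_le [Fintype V] [Fintype E] [DecidableEq V] {f : GraphFlow E}
    (hf : Γ.IsAcyclic f) (e : E) : |f e| ≤ ∑ v, |Γ.div f v| := by
  classical
  have main : ∀ a : E × Bool, 0 < f.val a → f.val a ≤ ∑ v, |Γ.div f v| := by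
    intro a ha
    set r : V → V → Prop := fun x y => ∃ b, Γ.tail b = x ∧ Γ.head b = y ∧ 0 < f.val b
    -- `R` is what positive flow reaches from the head of `a`. Nothing flows out of `R`, and by
    -- acyclicity the tail of `a` is outside, so the net flow into `R` is at least the flow on `a`.
    set R : Finset V := Finset.univ.filter fun w => Relation.ReflTransGen r (Γ.head a) w
    have hmem : ∀ w, w ∈ R ↔ Relation.ReflTransGen r (Γ.head a) w := fun w => by simp [R]
    have hhead : Γ.head a ∈ R := (hmem _).2 .refl
    have htail : Γ.tail a ∉ R := by
      intro h
      obtain ⟨m, c, h0, hp, hc, hm⟩ := Γ.exists_positive_path ((hmem _).1 h) a rfl ha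
      exact Γ.not_isAcyclic_of_closed ⟨m, c, hp, hc, by rw [hm, h0]⟩ hf
    have hclosed : ∀ b, 0 < f.val b → Γ.tail b ∈ R → Γ.head b ∈ R := fun b hb hR =>
      (hmem _).2 (((hmem _).1 hR).tail ⟨b, rfl, rfl, hb⟩)
    have hterm : ∀ e, 0 ≤ f e * ((if Γ.tgt e ∈ R then 1 else 0) -
        (if Γ.src e ∈ R then 1 else 0)) := by
      intro e
      have h1 := hclosed (e, true)
      have h2 := hclosed (e, false)
      simp only [GraphFlow.val, head, tail, if_true, Bool.false_eq_true, if_false] at h1 h2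
      by_cases ht : Γ.tgt e ∈ R <;> by_cases hs : Γ.src e ∈ R <;> simp [ht, hs] at h1 h2 ⊢ <;> omega
    calc f.val a = f a.1 * ((if Γ.tgt a.1 ∈ R then 1 else 0) -
            (if Γ.src a.1 ∈ R then 1 else 0)) := by
          obtain ⟨e, b⟩ := a
          cases b <;> simp [head, tail, GraphFlow.val] at hhead htail ⊢ <;> simp [hhead, htail]
      _ ≤ ∑ e, f e * ((if Γ.tgt e ∈ R then 1 else 0) - (if Γ.src e ∈ R then 1 else 0)) :=
          Finset.single_le_sum (fun e _ => hterm e) (Finset.mem_univ a.1)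
      _ = ∑ v ∈ R, Γ.div f v := (Γ.sum_div_finset f R).symm
      _ ≤ ∑ v ∈ R, |Γ.div f v| := Finset.sum_le_sum fun v _ => le_abs_self _
      _ ≤ ∑ v, |Γ.div f v| :=
          Finset.sum_le_univ_sum_of_nonneg fun v => abs_nonneg _
  rcases lt_trichotomy (f e) 0 with h | h | h
  · rw [abs_of_neg h]
    simpa [GraphFlow.val] using main (e, false) (by simpa [GraphFlow.val] using h)
  · rw [h, abs_zero]
    exact Finset.sum_nonneg fun v _ => abs_nonneg _
  · rw [abs_of_pos h]
    simpa [GraphFlow.val] using main (e, true) (by simpa [GraphFlow.val] using h)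

/-- A flow that is a positive rescaling of the coboundary of a potential is acyclic. -/
theorem isAcyclic_of_potential {f : GraphFlow E} {len : E → ℝ} (hlen : ∀ e, 0 < len e)
    {φ : V → ℝ} (hφ : ∀ e, φ (Γ.tgt e) - φ (Γ.src e) = len e * f e) : Γ.IsAcyclic f := by
  rintro ⟨m, c, ⟨hc, -, -⟩, hnn, i, hi⟩
  have hval : ∀ a, φ (Γ.head a) - φ (Γ.tail a) = len a.1 * f.val a := by
    rintro ⟨e, b⟩
    have := hφ e
    cases b <;> simp [head, tail, GraphFlow.val] <;> linarith
  -- The potential differences telescope around the cycle.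
  have hsum : ∑ i, len (c i).1 * (f.val (c i) : ℝ) = 0 := by
    simp only [← hval, Finset.sum_sub_distrib, hc]
    exact sub_eq_zero.2 (Equiv.sum_comp (Equiv.addRight 1) fun i => φ (Γ.tail (c i)))
  have hpos : 0 < ∑ i, len (c i).1 * (f.val (c i) : ℝ) :=
    Finset.sum_pos' (fun i _ => mul_nonneg (hlen _).le (by exact_mod_cast hnn i))
      ⟨i, Finset.mem_univ i, mul_pos (hlen _) (by exact_mod_cast hi)⟩
  exact hpos.ne' hsum

end Acyclic

end Multigraph

/-! ### Quasi-stable models and stability -/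

namespace Multigraph

variable {V E : Type*}

/-- The value of a flow on a quasi-stable model on the part of the edge `e` that ends at the target
of `e`. -/
def lastValue [DecidableEq E] {S : Finset E} (I : GraphFlow (E ⊕ {e // e ∈ S})) (e : E) : ℤ :=
  if h : e ∈ S then I (Sum.inr ⟨e, h⟩) else I (Sum.inl e)

theorem sum_extendZero [DecidableEq E] {S : Finset E} [Fintype V] [DecidableEq V] {M : Type*} [AddCommMonoid M] (u : V → M)
    (G : Finset (V ⊕ {e // e ∈ S})) :
    ∑ x ∈ G, extendZero u x = ∑ v with Sum.inl v ∈ G, u v := by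
  rw [← Finset.univ_inter G, ← Finset.sum_ite_mem, Fintype.sum_sum_type, Finset.sum_filter]
  simp [extendZero]

section Sums

variable [Fintype E] [DecidableEq E] {S : Finset E}

theorem sum_subdivided_edges {M : Type*} [AddCommMonoid M] (F : E ⊕ {e // e ∈ S} → M) :
    ∑ x, F x = ∑ e, (F (Sum.inl e) + if h : e ∈ S then F (Sum.inr ⟨e, h⟩) else 0) := by
  rw [Fintype.sum_sum_type, Finset.sum_add_distrib]
  congr 1
  rw [← Finset.sum_attach_eq_sum_dite S fun e => F (Sum.inr e)]
  rfl

end Sums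

section Cut

variable [DecidableEq V] [DecidableEq E] (Γ : Multigraph V E)

/-- The contribution of the edge `e` to the stability inequality for the vertex subset `G`. -/
noncomputable def cutTerm {S : Finset E} (I : GraphFlow (E ⊕ {e // e ∈ S})) (G : Finset V) (e : E) :
    ℝ :=
  if Γ.tgt e ∈ G then (if Γ.src e ∈ G then 0 else (lastValue I e : ℝ) - 1 / 2)
  else (if Γ.src e ∈ G then -(I (Sum.inl e) : ℝ) - 1 / 2 else 0)

variable [Fintype E]

theorem subdivide_div_inr {S : Finset E} (I : GraphFlow (E ⊕ {e // e ∈ S})) (x : {e // e ∈ S}) :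
    (Γ.subdivide S).div I (Sum.inr x) = I (Sum.inl x.1) - I (Sum.inr x) := by
  rw [div_apply, Fintype.sum_sum_type, Finset.sum_eq_single x.1, Finset.sum_eq_single x]
  · simp [subdivide, x.2]
    ring
  · intro y _ hy
    simp [subdivide, hy]
  · simp
  · intro e _ he
    by_cases hS : e ∈ S
    · have : (⟨e, hS⟩ : {e // e ∈ S}) ≠ x := fun h => he (congrArg Subtype.val h)
      simp [subdivide, hS, this]
    · simp [subdivide, hS]
  · simp

/-- At an exceptional vertex where the divisor has degree one, the flow jumps by one. -/
theorem inr_eq_inl_add_one {S : Finset E} {D : V ⊕ {e // e ∈ S} → ℤ}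
    {I : GraphFlow (E ⊕ {e // e ∈ S})} {δ : V → ℤ} (hD : IsAdmissible D)
    (hI : (Γ.subdivide S).div I = extendZero δ - D) (x : {e // e ∈ S}) :
    I (Sum.inr x) = I (Sum.inl x.1) + 1 := by
  have h := congrFun hI (Sum.inr x)
  rw [subdivide_div_inr] at h
  simp only [extendZero, Pi.sub_apply, Sum.elim_inr, hD x] at h
  omega

variable [Fintype V]

/-- Stability expressed by edges of the original graph: a lower bound by the cut terms, which is
attained for vertex sets without exceptional vertices. -/
theorem sum_sub_cutTerm_le {S : Finset E} {D : V ⊕ {e // e ∈ S} → ℤ}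
    {I : GraphFlow (E ⊕ {e // e ∈ S})} {δ : V → ℤ} (hD : IsAdmissible D)
    (hI : (Γ.subdivide S).div I = extendZero δ - D) (G : Finset (V ⊕ {e // e ∈ S})) :
    ((∑ v with Sum.inl v ∈ G, δ v : ℤ) : ℝ) -
        ∑ e, Γ.cutTerm I (Finset.univ.filter fun v => Sum.inl v ∈ G) e ≤
      ((∑ v ∈ G, D v : ℤ) : ℝ) + ((Γ.subdivide S).valence G : ℝ) / 2 := by
  have hDeq : D = extendZero δ - (Γ.subdivide S).div I := by rw [hI]; abel
  have h := (Γ.subdivide S).sum_div_sub_valence I G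
  rw [sum_subdivided_edges] at h
  rw [hDeq]
  simp only [Pi.sub_apply, Finset.sum_sub_distrib, sum_extendZero]
  push_cast at h ⊢
  suffices hle : ∑ e, _ ≤ ∑ e, Γ.cutTerm I (Finset.univ.filter fun v => Sum.inl v ∈ G) e by
    rw [← h] at hle
    linarith
  refine Finset.sum_le_sum fun e _ => ?_
  by_cases hS : e ∈ S
  · have hj : (I (Sum.inr ⟨e, hS⟩) : ℝ) = I (Sum.inl e) + 1 := by
      exact_mod_cast Γ.inr_eq_inl_add_one hD hI ⟨e, hS⟩
    -- Leaving the exceptional vertex out of `G` always gives the largest contribution, because the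
    -- flow jumps by one there; this is the value recorded by the cut term.
    by_cases h1 : Sum.inl (Γ.src e) ∈ G <;> by_cases h2 : Sum.inl (Γ.tgt e) ∈ G <;>
      by_cases h3 : Sum.inr ⟨e, hS⟩ ∈ G <;>
      simp [subdivide, cutTerm, lastValue, hS, h1, h2, h3, hj] <;> linarith
  · by_cases h1 : Sum.inl (Γ.src e) ∈ G <;> by_cases h2 : Sum.inl (Γ.tgt e) ∈ G <;>
      simp [subdivide, cutTerm, lastValue, hS, h1, h2]

/-- A subdivided edge with both ends in `G` is cut twice when its exceptional vertex is left out;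
the jump of one in the flow compensates the two halves, so it contributes zero. Equality here is
what transfers strictness from stability to the cut inequalities. -/
theorem sum_sub_cutTerm_eq {S : Finset E} {D : V ⊕ {e // e ∈ S} → ℤ}
    {I : GraphFlow (E ⊕ {e // e ∈ S})} {δ : V → ℤ} (hD : IsAdmissible D)
    (hI : (Γ.subdivide S).div I = extendZero δ - D) (G : Finset V) :
    ((∑ v ∈ G, δ v : ℤ) : ℝ) - ∑ e, Γ.cutTerm I G e =
      ((∑ v ∈ G.map Function.Embedding.inl, D v : ℤ) : ℝ) +
        ((Γ.subdivide S).valence (G.map Function.Embedding.inl) : ℝ) / 2 := by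
  have hDeq : D = extendZero δ - (Γ.subdivide S).div I := by rw [hI]; abel
  have h := (Γ.subdivide S).sum_div_sub_valence I (G.map Function.Embedding.inl)
  rw [sum_subdivided_edges] at h
  rw [hDeq]
  simp only [Pi.sub_apply, Finset.sum_sub_distrib, sum_extendZero]
  push_cast at h ⊢
  suffices heq : ∑ e, _ = ∑ e, Γ.cutTerm I G e by
    rw [← h] at heq
    simp at heq ⊢
    linarith
  refine Finset.sum_congr rfl fun e _ => ?_
  by_cases hS : e ∈ S
  · have hj : (I (Sum.inr ⟨e, hS⟩) : ℝ) = I (Sum.inl e) + 1 := by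
      exact_mod_cast Γ.inr_eq_inl_add_one hD hI ⟨e, hS⟩
    by_cases h1 : Γ.src e ∈ G <;> by_cases h2 : Γ.tgt e ∈ G <;>
      simp [subdivide, cutTerm, lastValue, hS, h1, h2, hj]
    ring
  · by_cases h1 : Γ.src e ∈ G <;> by_cases h2 : Γ.tgt e ∈ G <;>
      simp [subdivide, cutTerm, lastValue, hS, h1, h2]

/-- The stability inequality for a nonempty proper vertex subset. -/
theorem IsTriple.sum_cutTerm_lt {Γ : Multigraph V E} {θ : V → ℝ} {δ : V → ℤ} {S : Finset E}
    {D : V ⊕ {e // e ∈ S} → ℤ} {I : GraphFlow (E ⊕ {e // e ∈ S})} (h : Γ.IsTriple θ δ S D I)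
    {G : Finset V} (hne : G.Nonempty) (huniv : G ≠ Finset.univ) :
    ∑ e, Γ.cutTerm I G e < ((∑ v ∈ G, δ v : ℤ) : ℝ) - ∑ v ∈ G, θ v := by
  have heq := Γ.sum_sub_cutTerm_eq h.stable.1.1 h.div_eq G
  have hs := (h.stable.2 (G.map Function.Embedding.inl) ?_ ?_).1
  · rw [sum_extendZero] at hs
    simp only [Finset.mem_map, Function.Embedding.inl_apply, Sum.inl.injEq, exists_eq_right,
      Finset.filter_univ_mem] at hs
    linarith
  · obtain ⟨v, hv⟩ := hne
    intro hall
    simpa using hall (Sum.inl v) (by simpa using hv)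
  · obtain ⟨v, hv⟩ : ∃ v, v ∉ G := by
      by_contra! hcon
      exact huniv (Finset.eq_univ_iff_forall.2 hcon)
    intro hall
    simpa using hall (Sum.inl v) (by simpa using hv)

/-- A divisor is semistable once the cut inequalities hold. -/
theorem isSemistable_of_sum_cutTerm_le {θ : V → ℝ} {δ : V → ℤ} {S : Finset E}
    {D : V ⊕ {e // e ∈ S} → ℤ} {I : GraphFlow (E ⊕ {e // e ∈ S})} (hD : IsAdmissible D)
    (hI : (Γ.subdivide S).div I = extendZero δ - D) (hdeg : ∑ v, θ v = ((∑ v, δ v : ℤ) : ℝ))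
    (hcut : ∀ G : Finset V, ∑ e, Γ.cutTerm I G e ≤ ((∑ v ∈ G, δ v : ℤ) : ℝ) - ∑ v ∈ G, θ v) :
    Γ.IsSemistable θ S D := by
  have lower : ∀ G : Finset (V ⊕ {e // e ∈ S}), (∑ v ∈ G, extendZero θ v) -
      ((Γ.subdivide S).valence G : ℝ) / 2 ≤ ((∑ v ∈ G, D v : ℤ) : ℝ) := by
    intro G
    have h1 := Γ.sum_sub_cutTerm_le hD hI G
    have h2 := hcut (Finset.univ.filter fun v => Sum.inl v ∈ G)
    rw [sum_extendZero]
    linarith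
  have hval : ∀ G : Finset (V ⊕ {e // e ∈ S}),
      (Γ.subdivide S).valence Gᶜ = (Γ.subdivide S).valence G := by
    intro G
    simp only [valence, Finset.mem_compl, not_iff_not]
  have htot : ((∑ v, D v : ℤ) : ℝ) = ∑ v, extendZero (S := S) θ v := by
    have h0 := (Γ.subdivide S).sum_div_finset I Finset.univ
    rw [hI] at h0
    simp only [Pi.sub_apply, Finset.sum_sub_distrib, sum_extendZero, Finset.mem_univ, if_true,
      sub_self, mul_zero, Finset.sum_const_zero, Finset.filter_true] at h0 ⊢
    rw [hdeg, sub_eq_zero.1 h0]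
  refine ⟨hD, fun G => ⟨lower G, ?_⟩⟩
  -- The upper bound for `G` is the lower bound for its complement, as `D` and `θ` have equal totals
  -- and the valences agree.
  have h := lower Gᶜ
  rw [hval] at h
  have e1 := Finset.sum_add_sum_compl G D
  have e2 := Finset.sum_add_sum_compl G (extendZero (S := S) θ)
  rw [← e2, ← e1] at htot
  push_cast at htot h ⊢
  linarith

/-- The graph obtained by deleting the subdivided edges is connected. -/
theorem IsTriple.eqvGen {Γ : Multigraph V E} {θ : V → ℝ} {δ : V → ℤ} {S : Finset E}
    {D : V ⊕ {e // e ∈ S} → ℤ} {I : GraphFlow (E ⊕ {e // e ∈ S})} (h : Γ.IsTriple θ δ S D I)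
    (hdeg : ∑ v, θ v = ((∑ v, δ v : ℤ) : ℝ)) (u v : V) :
    Relation.EqvGen (fun x y => ∃ e, e ∉ S ∧ Γ.src e = x ∧ Γ.tgt e = y) u v := by
  classical
  set r : V → V → Prop := fun x y => ∃ e, e ∉ S ∧ Γ.src e = x ∧ Γ.tgt e = y
  set G : Finset V := Finset.univ.filter fun w => Relation.EqvGen r u w
  have hmem : ∀ w, w ∈ G ↔ Relation.EqvGen r u w := fun w => by simp [G]
  by_contra hv
  have hu : u ∈ G := (hmem u).2 (.refl u)
  have hv' : v ∉ G := fun h => hv ((hmem v).1 h)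
  have h1 := h.sum_cutTerm_lt ⟨u, hu⟩ fun h => hv' (h ▸ Finset.mem_univ v)
  have h2 := h.sum_cutTerm_lt (G := Gᶜ) ⟨v, Finset.mem_compl.2 hv'⟩ fun h =>
    Finset.mem_compl.1 (h ▸ Finset.mem_univ u) hu
  -- A cut edge is subdivided, so its two terms are `I e + 1 - 1/2` and `-I e - 1/2`. Strict
  -- stability of `G` and of its complement then sums to `0 < 0`.
  have hzero : ∀ e, Γ.cutTerm I G e + Γ.cutTerm I Gᶜ e = 0 := by
    intro e
    by_cases hS : e ∈ S
    · have hj : (I (Sum.inr ⟨e, hS⟩) : ℝ) = I (Sum.inl e) + 1 := by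
        exact_mod_cast Γ.inr_eq_inl_add_one h.stable.1.1 h.div_eq ⟨e, hS⟩
      by_cases hs : Γ.src e ∈ G <;> by_cases ht : Γ.tgt e ∈ G <;>
        simp [cutTerm, lastValue, hS, hs, ht, hj] <;> ring
    · have hiff : Γ.src e ∈ G ↔ Γ.tgt e ∈ G := by
        have hr : Relation.EqvGen r (Γ.src e) (Γ.tgt e) := .rel _ _ ⟨e, hS, rfl, rfl⟩
        rw [hmem, hmem]
        exact ⟨fun h => h.trans _ _ _ hr, fun h => h.trans _ _ _ (hr.symm _ _)⟩
      by_cases ht : Γ.tgt e ∈ G <;> simp [cutTerm, hiff, ht]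
  have h3 : ∑ e, Γ.cutTerm I G e + ∑ e, Γ.cutTerm I Gᶜ e = 0 := by
    rw [← Finset.sum_add_distrib]
    exact Finset.sum_eq_zero fun e _ => hzero e
  have e1 := Finset.sum_add_sum_compl G δ
  have e2 := Finset.sum_add_sum_compl G θ
  rw [← e2, ← e1] at hdeg
  push_cast at hdeg h1 h2
  linarith

end Cut

end Multigraph

/-! ### The cones of edge lengths -/

/-- Generators of the image lift uniquely to the cone. This allows a cone in `Hom(P, ℝ)` to be
studied in coordinates. -/
theorem IsRationalPolyhedral.of_map {N N' : Type*} [AddCommGroup N] [Module ℝ N] [AddCommGroup N']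
    [Module ℝ N'] {L : AddSubgroup N} {L' : AddSubgroup N'} {C : PointedCone ℝ N} {J : N →ₗ[ℝ] N'}
    (hJ : Function.Injective J) (hL : ∀ x ∈ C, J x ∈ L' → x ∈ L)
    (h : IsRationalPolyhedral L' (C.map J)) : IsRationalPolyhedral L C := by
  obtain ⟨t, ht, hC⟩ := h
  have hsub : ∀ y ∈ t, ∃ x ∈ C, J x = y := fun y hy =>
    PointedCone.mem_map.1 (hC ▸ PointedCone.subset_hull hy)
  have heq : C = PointedCone.hull ℝ ((t.preimage J hJ.injOn : Finset N) : Set N) := by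
    refine Submodule.map_injective_of_injective (f := (J : N →ₗ[{c : ℝ // 0 ≤ c}] N')) hJ ?_
    change C.map J = (PointedCone.hull ℝ _).map J
    rw [hC, PointedCone.map_hull, Finset.coe_preimage, Set.image_preimage_eq_of_subset]
    intro y hy
    obtain ⟨x, -, hx⟩ := hsub y hy
    exact ⟨x, hx⟩
  refine ⟨_, fun x hx => ?_, heq⟩
  have hx' : J x ∈ t := Finset.mem_preimage.1 hx
  obtain ⟨z, hz, hzx⟩ := hsub _ hx'
  exact hL x (hJ hzx ▸ hz) (ht hx')

theorem intFunctional_sub {X : Type*} [Fintype X] (a b : X → ℤ) (x : X → ℝ) :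
    intFunctional (a - b) x = intFunctional a x - intFunctional b x := by
  simp [intFunctional_apply, sub_mul, Finset.sum_sub_distrib]

theorem intFunctional_single {X : Type*} [Fintype X] [DecidableEq X] (i : X) (z : ℤ) (x : X → ℝ) :
    intFunctional (Pi.single i z) x = z * x i := by
  rw [intFunctional_apply, Finset.sum_eq_single i (fun b _ hb => by simp [hb]) (by simp)]
  simp

namespace Multigraph

variable {V E : Type*} [DecidableEq E]

theorem Connected.subdivide {Γ : Multigraph V E} (hΓ : Γ.Connected) (S : Finset E) :
    (Γ.subdivide S).Connected := by
  set r : V ⊕ {e // e ∈ S} → V ⊕ {e // e ∈ S} → Prop :=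
    fun x y => ∃ e, (Γ.subdivide S).src e = x ∧ (Γ.subdivide S).tgt e = y
  have hsrc : ∀ x : {e // e ∈ S}, Relation.EqvGen r (Sum.inl (Γ.src x.1)) (Sum.inr x) :=
    fun x => .rel _ _ ⟨Sum.inl x.1, rfl, by simp [Multigraph.subdivide]⟩
  have htgt : ∀ x : {e // e ∈ S}, Relation.EqvGen r (Sum.inr x) (Sum.inl (Γ.tgt x.1)) :=
    fun x => .rel _ _ ⟨Sum.inr x, rfl, rfl⟩
  have hinl : ∀ u v, Relation.EqvGen r (Sum.inl u) (Sum.inl v) := by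
    intro u v
    induction hΓ.2 u v with
    | rel x y h =>
      obtain ⟨e, rfl, rfl⟩ := h
      by_cases hS : e ∈ S
      · exact (hsrc ⟨e, hS⟩).trans _ _ _ (htgt ⟨e, hS⟩)
      · exact .rel _ _ ⟨Sum.inl e, rfl, by simp [Multigraph.subdivide, hS]⟩
    | refl x => exact .refl _
    | symm x y _ ih => exact ih.symm _ _
    | trans x y z _ _ ih1 ih2 => exact ih1.trans _ _ _ ih2
  have hbase : ∀ x, ∃ u, Relation.EqvGen r x (Sum.inl u) := by
    rintro (u | x)
    · exact ⟨u, .refl _⟩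
    · exact ⟨_, htgt x⟩
  refine ⟨hΓ.1.map Sum.inl, fun x y => ?_⟩
  obtain ⟨u, hu⟩ := hbase x
  obtain ⟨v, hv⟩ := hbase y
  exact hu.trans _ _ _ ((hinl u v).trans _ _ _ (hv.symm _ _))

section Projection

variable {S : Finset E}

theorem prLen_apply_of_mem (len : E ⊕ {e // e ∈ S} → ℝ) {e : E} (h : e ∈ S) :
    prLen S len e = len (Sum.inl e) + len (Sum.inr ⟨e, h⟩) := by
  simp [prLen, h]

theorem prLen_apply_of_notMem (len : E ⊕ {e // e ∈ S} → ℝ) {e : E} (h : e ∉ S) :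
    prLen S len e = len (Sum.inl e) := by
  simp [prLen, h]

theorem prLen_mem_latticeFun {len : E ⊕ {e // e ∈ S} → ℝ} (h : len ∈ latticeFun _) :
    prLen S len ∈ latticeFun E := by
  intro e
  obtain ⟨a, ha⟩ := h (Sum.inl e)
  by_cases hS : e ∈ S
  · obtain ⟨b, hb⟩ := h (Sum.inr ⟨e, hS⟩)
    exact ⟨a + b, by rw [prLen_apply_of_mem _ hS, ha, hb]; push_cast; rfl⟩
  · exact ⟨a, by rw [prLen_apply_of_notMem _ hS, ha]⟩

/-- Potential differences along edges that are not subdivided are integral linear functions of the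
edge lengths on the original graph. -/
theorem exists_intFunctional_potential [Fintype E] {Γ : Multigraph V E} {u v : V}
    (h : Relation.EqvGen (fun x y => ∃ e, e ∉ S ∧ Γ.src e = x ∧ Γ.tgt e = y) u v)
    (I : GraphFlow (E ⊕ {e // e ∈ S})) :
    ∃ a : E → ℤ, ∀ (len : E ⊕ {e // e ∈ S} → ℝ) (φ : V ⊕ {e // e ∈ S} → ℝ),
      (∀ i, φ ((Γ.subdivide S).tgt i) - φ ((Γ.subdivide S).src i) = len i * I i) →
      φ (Sum.inl v) - φ (Sum.inl u) = intFunctional a (prLen S len) := by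
  induction h with
  | rel x y h =>
    obtain ⟨e, hS, rfl, rfl⟩ := h
    refine ⟨Pi.single e (I (Sum.inl e)), fun len φ hφ => ?_⟩
    have h1 := hφ (Sum.inl e)
    rw [intFunctional_single, prLen_apply_of_notMem _ hS]
    simp only [subdivide, Sum.elim_inl, hS, dif_neg, not_false_eq_true] at h1
    rw [h1, mul_comm]
  | refl x => exact ⟨0, fun len φ _ => by simp [intFunctional_apply]⟩
  | symm x y _ ih =>
    obtain ⟨a, ha⟩ := ih
    refine ⟨0 - a, fun len φ hφ => ?_⟩
    rw [intFunctional_sub, ← ha len φ hφ]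
    simp [intFunctional_apply]
  | trans x y z _ _ ih1 ih2 =>
    obtain ⟨a, ha⟩ := ih1
    obtain ⟨b, hb⟩ := ih2
    refine ⟨b - (0 - a), fun len φ hφ => ?_⟩
    rw [intFunctional_sub, intFunctional_sub, ← ha len φ hφ, ← hb len φ hφ]
    simp [intFunctional_apply]

/-- A potential on the vertices of `Γ` extends to the exceptional vertices. -/
theorem extend_potential {Γ : Multigraph V E} {I : GraphFlow (E ⊕ {e // e ∈ S})}
    (hI : ∀ x : {e // e ∈ S}, I (Sum.inr x) = I (Sum.inl x.1) + 1)
    {x t : E → ℝ} {φ : V → ℝ} (ht : ∀ e ∉ S, t e = 0)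
    (hφ : ∀ e, φ (Γ.tgt e) - φ (Γ.src e) = x e * I (Sum.inl e) + t e)
    (i : E ⊕ {e // e ∈ S}) :
    (Sum.elim φ fun y : {e // e ∈ S} => φ (Γ.src y.1) + (x y.1 - t y.1) * I (Sum.inl y.1))
        ((Γ.subdivide S).tgt i) -
      (Sum.elim φ fun y : {e // e ∈ S} => φ (Γ.src y.1) + (x y.1 - t y.1) * I (Sum.inl y.1))
        ((Γ.subdivide S).src i) =
      (Sum.elim (fun e => x e - t e) fun y : {e // e ∈ S} => t y.1) i * I i := by
  rcases i with e | y
  · have h4 := hφ e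
    by_cases hS : e ∈ S
    · simp [subdivide, hS]
    · rw [ht e hS] at h4
      simp [subdivide, hS, ht e hS]
      linarith
  · have h4 := hφ y.1
    simp [subdivide, hI]
    linarith

end Projection

section Lengths

variable [Fintype E] [DecidableEq V] {Γ : Multigraph V E} {S : Finset E}
  {I : GraphFlow (E ⊕ {e // e ∈ S})}

theorem mem_tauOrthant_iff [Fintype V] (hΓ : Γ.Connected) {len : E ⊕ {e // e ∈ S} → ℝ} :
    len ∈ Γ.tauOrthant S I ↔ (∀ i, 0 ≤ len i) ∧ ∃ φ : V ⊕ {e // e ∈ S} → ℝ,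
      ∀ i, φ ((Γ.subdivide S).tgt i) - φ ((Γ.subdivide S).src i) = len i * I i :=
  and_congr Iff.rfl ((Γ.subdivide S).pairing_eq_zero_iff (hΓ.subdivide S) len I)

/-- Edge lengths on `Γ` lie in the image cone if and only if there is a potential on the vertices
whose difference along an edge `e` of length `x e` is realized by the slopes `I e` and `I e + 1`,
the latter on a part of length `t e`. -/
theorem mem_sigmaOrthant_iff [Fintype V] (hΓ : Γ.Connected)
    (hI : ∀ x : {e // e ∈ S}, I (Sum.inr x) = I (Sum.inl x.1) + 1) {x : E → ℝ} :
    x ∈ Γ.sigmaOrthant S I ↔ ∃ (φ : V → ℝ) (t : E → ℝ), ∀ e, 0 ≤ t e ∧ t e ≤ x e ∧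
      (e ∉ S → t e = 0) ∧ φ (Γ.tgt e) - φ (Γ.src e) = x e * I (Sum.inl e) + t e := by
  constructor
  · rintro ⟨len, hlen, rfl⟩
    obtain ⟨hpos, φ, hφ⟩ := (mem_tauOrthant_iff hΓ).1 hlen
    refine ⟨fun v => φ (Sum.inl v), fun e => if h : e ∈ S then len (Sum.inr ⟨e, h⟩) else 0,
      fun e => ?_⟩
    have h1 := hφ (Sum.inl e)
    have h1' := hpos (Sum.inl e)
    by_cases hS : e ∈ S
    · have h2 := hφ (Sum.inr ⟨e, hS⟩)
      have h2' := hpos (Sum.inr ⟨e, hS⟩)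
      change _ ∧ _ ≤ prLen S len e ∧ _ ∧ _ = prLen S len e * _ + _
      rw [prLen_apply_of_mem _ hS]
      rw [hI] at h2
      simp [subdivide, hS] at h1 h2 ⊢
      exact ⟨h2', h1', by linarith⟩
    · change _ ∧ _ ≤ prLen S len e ∧ _ ∧ _ = prLen S len e * _ + _
      rw [prLen_apply_of_notMem _ hS]
      simp [subdivide, hS] at h1 ⊢
      exact ⟨h1', h1⟩
  · rintro ⟨φ, t, h⟩
    refine ⟨Sum.elim (fun e => x e - t e) fun y => t y.1, ?_, ?_⟩
    · refine (mem_tauOrthant_iff hΓ).2 ⟨?_, _,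
        extend_potential hI (fun e => (h e).2.2.1) fun e => (h e).2.2.2⟩
      rintro (e | y)
      · exact sub_nonneg.2 (h e).2.1
      · exact (h y.1).1
    · funext e
      by_cases hS : e ∈ S
      · change prLen S _ e = _
        rw [prLen_apply_of_mem _ hS]
        simp
      · change prLen S _ e = _
        rw [prLen_apply_of_notMem _ hS]
        simp [(h e).2.2.1 hS]

theorem IsTriple.inr_eq [Fintype V] {θ : V → ℝ} {δ : V → ℤ} {D : V ⊕ {e // e ∈ S} → ℤ}
    (h : Γ.IsTriple θ δ S D I) (x : {e // e ∈ S}) : I (Sum.inr x) = I (Sum.inl x.1) + 1 :=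
  Γ.inr_eq_inl_add_one h.stable.1.1 h.div_eq x

/-! ### Intersections are faces -/

/-- The rise along an edge is largest when its final slope is used throughout. With the lower bound
by the initial slope, this compares real rises with integer flows. -/
theorem IsTriple.le_lastValue [Fintype V] {θ : V → ℝ} {δ : V → ℤ} {D : V ⊕ {e // e ∈ S} → ℤ}
    (h : Γ.IsTriple θ δ S D I) {e : E} {x t : ℝ} (h2 : t ≤ x) (h3 : e ∉ S → t = 0) :
    x * I (Sum.inl e) + t ≤ x * lastValue I e := by
  by_cases hS : e ∈ S
  · have := h.inr_eq ⟨e, hS⟩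
    simp only [lastValue, hS, dif_pos, this]
    push_cast
    linarith
  · simp [lastValue, hS, h3 hS]

/-- The potentials of two triples on the same edge lengths differ by a constant. -/
theorem IsTriple.potential_sub_eq [Fintype V] {θ : V → ℝ} {δ : V → ℤ} {S' : Finset E}
    {D : V ⊕ {e // e ∈ S} → ℤ} {D' : V ⊕ {e // e ∈ S'} → ℤ} {I' : GraphFlow (E ⊕ {e // e ∈ S'})}
    (h : Γ.IsTriple θ δ S D I) (h' : Γ.IsTriple θ δ S' D' I')
    (hdeg : ∑ v, θ v = ((∑ v, δ v : ℤ) : ℝ)) {x t t' : E → ℝ} {φ φ' : V → ℝ}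
    (hφ : ∀ e, 0 ≤ t e ∧ t e ≤ x e ∧ (e ∉ S → t e = 0) ∧
      φ (Γ.tgt e) - φ (Γ.src e) = x e * I (Sum.inl e) + t e)
    (hφ' : ∀ e, 0 ≤ t' e ∧ t' e ≤ x e ∧ (e ∉ S' → t' e = 0) ∧
      φ' (Γ.tgt e) - φ' (Γ.src e) = x e * I' (Sum.inl e) + t' e) (u v : V) :
    φ u - φ' u = φ v - φ' v := by
  obtain ⟨w, -, hw⟩ := Finset.exists_max_image Finset.univ (fun v => φ v - φ' v)
    ⟨u, Finset.mem_univ u⟩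
  suffices hall : ∀ v, φ v - φ' v = φ w - φ' w by rw [hall u, hall v]
  by_contra! hne
  obtain ⟨v, hv⟩ := hne
  set G : Finset V := Finset.univ.filter fun v => φ v - φ' v = φ w - φ' w
  have hmem : ∀ v, v ∈ G ↔ φ v - φ' v = φ w - φ' w := fun v => by simp [G]
  have hwG : w ∈ G := (hmem w).2 rfl
  have hvG : v ∉ G := fun hh => hv ((hmem v).1 hh)
  have hlt : ∀ a ∈ G, ∀ b ∉ G, φ b - φ' b < φ a - φ' a := by
    intro a ha b hb
    rw [(hmem a).1 ha]
    exact lt_of_le_of_ne (hw b (Finset.mem_univ b)) fun hh => hb ((hmem b).2 hh)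
  have h1 := h.sum_cutTerm_lt ⟨w, hwG⟩ fun hh => hvG (hh ▸ Finset.mem_univ v)
  have h2 := h'.sum_cutTerm_lt (G := Gᶜ) ⟨v, Finset.mem_compl.2 hvG⟩ fun hh =>
    Finset.mem_compl.1 (hh ▸ Finset.mem_univ w) hwG
  -- Integrality upgrades a strict inequality of slopes to a gap of one, exactly the two halves in
  -- the cut terms of `G` and `Gᶜ`.
  have hslope : ∀ (a b : ℤ) (y : ℝ), 0 ≤ y → y * a < y * b → (1 : ℝ) ≤ b - a := by
    intro a b y hy hab
    have : a < b := by exact_mod_cast lt_of_mul_lt_mul_left hab hy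
    have : a + 1 ≤ b := this
    have : ((a + 1 : ℤ) : ℝ) ≤ b := by exact_mod_cast this
    push_cast at this
    linarith
  have hnonneg : ∀ e, 0 ≤ Γ.cutTerm I G e + Γ.cutTerm I' Gᶜ e := by
    intro e
    obtain ⟨p1, p2, p3, p4⟩ := hφ e
    obtain ⟨q1, q2, q3, q4⟩ := hφ' e
    have p5 := h.le_lastValue p2 p3
    have q5 := h'.le_lastValue q2 q3
    by_cases hs : Γ.src e ∈ G <;> by_cases ht : Γ.tgt e ∈ G <;>
      simp only [cutTerm, hs, ht, Finset.mem_compl, not_true_eq_false, not_false_eq_true, if_true,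
        if_false, add_zero, le_refl]
    · have h3 := hlt _ hs _ ht
      have h4 := hslope (I (Sum.inl e)) (lastValue I' e) (x e) (p1.trans p2) (by linarith)
      linarith
    · have h3 := hlt _ ht _ hs
      have h4 := hslope (I' (Sum.inl e)) (lastValue I e) (x e) (p1.trans p2) (by linarith)
      linarith
  have h3 : 0 ≤ ∑ e, Γ.cutTerm I G e + ∑ e, Γ.cutTerm I' Gᶜ e := by
    rw [← Finset.sum_add_distrib]
    exact Finset.sum_nonneg fun e _ => hnonneg e
  have e1 := Finset.sum_add_sum_compl G δ
  have e2 := Finset.sum_add_sum_compl G θ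
  rw [← e2, ← e1] at hdeg
  push_cast at hdeg h1 h2
  linarith

/-- The sum of the potentials of `x` and `y` is the potential of `x + y` for the second triple, up
to a constant. On each edge the slopes of the two triples differ by so little that the summand `x`
by itself already fits the second triple. -/
theorem IsTriple.mem_sigmaOrthant_of_add_mem [Fintype V] (hΓ : Γ.Connected) {θ : V → ℝ} {δ : V → ℤ}
    {S' : Finset E} {D : V ⊕ {e // e ∈ S} → ℤ} {D' : V ⊕ {e // e ∈ S'} → ℤ}
    {I' : GraphFlow (E ⊕ {e // e ∈ S'})} (h : Γ.IsTriple θ δ S D I) (h' : Γ.IsTriple θ δ S' D' I')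
    (hdeg : ∑ v, θ v = ((∑ v, δ v : ℤ) : ℝ)) {x y : E → ℝ} (hx : x ∈ Γ.sigmaOrthant S I)
    (hy : y ∈ Γ.sigmaOrthant S I) (hxy : x + y ∈ Γ.sigmaOrthant S' I') :
    x ∈ Γ.sigmaOrthant S' I' := by
  obtain ⟨φ, t, hφ⟩ := (mem_sigmaOrthant_iff hΓ h.inr_eq).1 hx
  obtain ⟨ψ, s, hψ⟩ := (mem_sigmaOrthant_iff hΓ h.inr_eq).1 hy
  obtain ⟨φ', t', hφ'⟩ := (mem_sigmaOrthant_iff hΓ h'.inr_eq).1 hxy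
  have hconst := h.potential_sub_eq h' hdeg (x := x + y) (t := t + s) (φ := φ + ψ)
    (fun e => by
      obtain ⟨p1, p2, p3, p4⟩ := hφ e
      obtain ⟨q1, q2, q3, q4⟩ := hψ e
      refine ⟨add_nonneg p1 q1, add_le_add p2 q2, fun hS => ?_, ?_⟩
      · simp [p3 hS, q3 hS]
      · simp only [Pi.add_apply]
        linarith) hφ'
  -- The potential of `x` is kept; the new length of the steeper piece is forced by rewriting its
  -- rise with initial slope `I'`.
  refine (mem_sigmaOrthant_iff hΓ h'.inr_eq).2
    ⟨φ, fun e => x e * (I (Sum.inl e) - I' (Sum.inl e) : ℤ) + t e, fun e => ?_⟩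
  obtain ⟨p1, p2, p3, p4⟩ := hφ e
  obtain ⟨q1, q2, q3, q4⟩ := hψ e
  obtain ⟨r1, r2, r3, r4⟩ := hφ' e
  have hc := hconst (Γ.tgt e) (Γ.src e)
  simp only [Pi.add_apply] at hc r2 r4
  have hk : (x e + y e) * ((I (Sum.inl e) - I' (Sum.inl e) : ℤ) : ℝ) + (t e + s e) = t' e := by
    push_cast
    linarith
  have hlast : φ (Γ.tgt e) - φ (Γ.src e) = x e * I' (Sum.inl e) +
      (x e * ((I (Sum.inl e) - I' (Sum.inl e) : ℤ) : ℝ) + t e) := by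
    push_cast
    linarith
  beta_reduce
  generalize I (Sum.inl e) - I' (Sum.inl e) = k at hk hlast ⊢
  rw [← and_assoc, ← and_assoc]
  refine ⟨?_, hlast⟩
  rcases (by linarith : 0 ≤ x e + y e).eq_or_lt with hz | hz
  · have hx0 : x e = 0 := by linarith
    have ht0 : t e = 0 := by linarith
    simp [hx0, ht0]
  · have k1 : (-2 : ℝ) < k := by
      by_contra! hcon
      nlinarith
    have k2 : (k : ℝ) < 2 := by
      by_contra! hcon
      nlinarith
    have k1' : -2 < k := by exact_mod_cast k1
    have k2' : k < 2 := by exact_mod_cast k2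
    obtain rfl | rfl | rfl : k = -1 ∨ k = 0 ∨ k = 1 := by omega
    · push_cast at hk ⊢
      have ht : t e = x e := by linarith
      simp [ht, p1.trans p2]
    · push_cast at hk ⊢
      refine ⟨⟨by linarith, by linarith⟩, fun hS => ?_⟩
      have := r3 hS
      linarith
    · push_cast at hk ⊢
      refine ⟨⟨by linarith, by linarith⟩, fun hS => ?_⟩
      have := r3 hS
      linarith

/-! ### The projection is an isomorphism on the cones -/

/-- An integral linear section of the projection of the cone of a triple. -/
theorem IsTriple.exists_section [Fintype V] (hΓ : Γ.Connected) {θ : V → ℝ} {δ : V → ℤ}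
    {D : V ⊕ {e // e ∈ S} → ℤ} (h : Γ.IsTriple θ δ S D I)
    (hdeg : ∑ v, θ v = ((∑ v, δ v : ℤ) : ℝ)) :
    ∃ g : (E → ℝ) →ₗ[ℝ] (E ⊕ {e // e ∈ S} → ℝ), (∀ y ∈ latticeFun E, g y ∈ latticeFun _) ∧
      ∀ len ∈ Γ.tauOrthant S I, g (prLen S len) = len := by
  choose a ha using fun e => exists_intFunctional_potential (h.eqvGen hdeg (Γ.src e) (Γ.tgt e)) I
  -- The rise along `e` minus `I e` times its length is the length of the steeper part. The
  -- coefficients depend only on `I` and on chosen paths of unsubdivided edges, not on the lengths,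
  -- so they define a linear section.
  set b : E → E → ℤ := fun e => a e - Pi.single e (I (Sum.inl e))
  set m : E ⊕ {e // e ∈ S} → E → ℤ :=
    Sum.elim (fun e => Pi.single e 1 - if e ∈ S then b e else 0) fun x => b x.1
  refine ⟨LinearMap.pi fun i => intFunctional (m i), fun y hy i => ?_, fun len hlen => ?_⟩
  · exact intFunctional_mem_latticeFun (m i) hy
  · obtain ⟨-, φ, hφ⟩ := (mem_tauOrthant_iff hΓ).1 hlen
    have hb : ∀ x : {e // e ∈ S}, intFunctional (b x.1) (prLen S len) = len (Sum.inr x) := by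
      intro x
      rw [intFunctional_sub, ← ha x.1 len φ hφ, intFunctional_single, prLen_apply_of_mem _ x.2]
      have h1 := hφ (Sum.inl x.1)
      have h2 := hφ (Sum.inr x)
      rw [h.inr_eq] at h2
      simp [subdivide] at h1 h2 ⊢
      linarith
    funext i
    rw [LinearMap.pi_apply]
    rcases i with e | x
    · simp only [m, Sum.elim_inl, intFunctional_sub, intFunctional_single]
      by_cases hS : e ∈ S
      · rw [if_pos hS, hb ⟨e, hS⟩, prLen_apply_of_mem _ hS]
        simp
      · rw [if_neg hS, prLen_apply_of_notMem _ hS]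
        simp [intFunctional_apply]
    · exact hb x

theorem IsTriple.isConeIso_orthant [Fintype V] (hΓ : Γ.Connected) {θ : V → ℝ} {δ : V → ℤ}
    {D : V ⊕ {e // e ∈ S} → ℤ} (h : Γ.IsTriple θ δ S D I)
    (hdeg : ∑ v, θ v = ((∑ v, δ v : ℤ) : ℝ)) :
    IsConeIso (latticeFun _) (latticeFun E) (prLen S) (Γ.tauOrthant S I) (Γ.sigmaOrthant S I) := by
  obtain ⟨g, hg, hgp⟩ := h.exists_section hΓ hdeg
  refine ⟨fun x hx => ⟨x, hx, rfl⟩, fun x _ hx => prLen_mem_latticeFun hx, g, ?_,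
    fun y _ hy => hg y hy, hgp, ?_⟩
  · rintro _ ⟨x, hx, rfl⟩
    exact (hgp x hx).symm ▸ hx
  · rintro _ ⟨x, hx, rfl⟩
    exact congrArg (prLen S) (hgp x hx)

/-- The inverse sends `p` to `p` together with the integral section applied to the lengths `p (ℓ
e)`. -/
theorem IsTriple.isConeIso [Fintype V] (hΓ : Γ.Connected) {P : Type*} [AddCommMonoid P] (ℓ : E → P)
    {θ : V → ℝ} {δ : V → ℤ} {D : V ⊕ {e // e ∈ S} → ℤ} (h : Γ.IsTriple θ δ S D I)
    (hdeg : ∑ v, θ v = ((∑ v, δ v : ℤ) : ℝ)) :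
    IsConeIso ((latticeHom P).prod (latticeFun _)) (latticeHom P) (LinearMap.fst ℝ (P →+ ℝ) _)
      (Γ.tau ℓ S I) (Γ.sigma ℓ S I) := by
  obtain ⟨g, hg, hgp⟩ := h.exists_section hΓ hdeg
  set π : (P →+ ℝ) →ₗ[ℝ] (E → ℝ) :=
    { toFun := fun p e => p (ℓ e)
      map_add' := fun p q => rfl
      map_smul' := fun c p => rfl }
  have key : ∀ x ∈ Γ.tau ℓ S I, (LinearMap.id.prod (g.comp π)) x.1 = x := by
    rintro x ⟨⟨-, -, hx⟩, hx'⟩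
    refine Prod.ext rfl ?_
    change g (π x.1) = x.2
    have : π x.1 = prLen S x.2 := hx.symm
    rw [this]
    exact hgp _ hx'
  refine ⟨fun x hx => ⟨x, hx, rfl⟩, fun x _ hx => hx.1, LinearMap.id.prod (g.comp π), ?_,
    fun y _ hy => ⟨hy, hg _ fun e => hy (ℓ e)⟩, key, fun y _ => rfl⟩
  rintro _ ⟨x, hx, rfl⟩
  change (LinearMap.id.prod (g.comp π)) x.1 ∈ _
  exact (key x hx).symm ▸ hx

/-- Reduces support, strong convexity and intersections over `P` to nonnegative homomorphisms and
the cones of real edge lengths. -/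
theorem mem_sigma_iff {P : Type*} [AddCommMonoid P] {ℓ : E → P} {p : P →+ ℝ} :
    p ∈ Γ.sigma ℓ S I ↔ p ∈ dualCone P ∧ (fun e => p (ℓ e)) ∈ Γ.sigmaOrthant S I := by
  constructor
  · rintro ⟨x, ⟨⟨h1, -, h3⟩, h4⟩, rfl⟩
    exact ⟨h1, x.2, h4, h3⟩
  · rintro ⟨h1, len, h2, h3⟩
    exact ⟨(p, len), ⟨⟨h1, h2.1, h3⟩, h2⟩, rfl⟩

/-- With the continuous section `g`, membership of `y` amounts to the closed conditions that `g y`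
lies in the closed cone upstairs and projects back to `y`. -/
theorem IsTriple.isClosed_sigmaOrthant [Fintype V] (hΓ : Γ.Connected) {θ : V → ℝ} {δ : V → ℤ}
    {D : V ⊕ {e // e ∈ S} → ℤ} (h : Γ.IsTriple θ δ S D I)
    (hdeg : ∑ v, θ v = ((∑ v, δ v : ℤ) : ℝ)) :
    IsClosed (Γ.sigmaOrthant S I : Set (E → ℝ)) := by
  obtain ⟨-, -, g, hg, -, -, hpg⟩ := h.isConeIso_orthant hΓ hdeg
  have hgc : Continuous g := LinearMap.continuous_of_finiteDimensional g
  have hpc : Continuous (prLen S) := LinearMap.continuous_of_finiteDimensional _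
  have hτ : IsClosed (Γ.tauOrthant S I : Set (E ⊕ {e // e ∈ S} → ℝ)) := by
    have : (Γ.tauOrthant S I : Set (E ⊕ {e // e ∈ S} → ℝ)) = {len | ∀ i, 0 ≤ len i} ∩
        ⋂ γ ∈ (Γ.subdivide S).H1, {len | GraphFlow.pairing len γ I = 0} := by
      ext len
      simp only [Set.mem_inter_iff, Set.mem_iInter]
      exact Iff.rfl
    rw [this]
    refine IsClosed.inter ?_ (isClosed_biInter fun γ _ => isClosed_eq ?_ continuous_const)
    · rw [Set.ofPred_forall]
      exact isClosed_iInter fun i => isClosed_le continuous_const (continuous_apply i)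
    · simp only [GraphFlow.pairing_eq_sum]
      fun_prop
  have : (Γ.sigmaOrthant S I : Set (E → ℝ)) =
      g ⁻¹' (Γ.tauOrthant S I) ∩ {y | prLen S (g y) = y} := by
    ext y
    refine ⟨fun hy => ⟨hg y hy, hpg y hy⟩, fun hy => ⟨g y, hy.1, hy.2⟩⟩
  rw [this]
  exact (hτ.preimage hgc).inter (isClosed_eq (hpc.comp hgc) continuous_id)

/-! ### Finiteness -/

/-- Semistability at single vertices bounds `D`, hence `div I`, and acyclicity then bounds `I`. The
map `F` is arbitrary so that both families of cones are covered. -/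
theorem finite_setOf_isTriple [Fintype V] (Γ : Multigraph V E) (θ : V → ℝ) (δ : V → ℤ)
    {α : Type*} (F : ∀ S : Finset E, GraphFlow (E ⊕ {e // e ∈ S}) → α) :
    {C | ∃ S D I, Γ.IsTriple θ δ S D I ∧ C = F S I}.Finite := by
  have hflow : ∀ S : Finset E, {I | ∃ D, Γ.IsTriple θ δ S D I}.Finite := by
    intro S
    set b : V ⊕ {e // e ∈ S} → ℤ := fun v =>
      ⌈|extendZero (S := S) θ v| + ((Γ.subdivide S).valence {v} : ℝ) / 2⌉
    set B : ℤ := ∑ v, (|extendZero (S := S) δ v| + b v)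
    refine (Set.finite_Icc (fun _ => -B) fun _ => B).subset ?_
    rintro I ⟨D, h⟩
    have hD : ∀ v, |D v| ≤ b v := by
      intro v
      obtain ⟨h1, h2⟩ := h.stable.1.2 {v}
      simp only [Finset.sum_singleton] at h1 h2
      have h3 : |(D v : ℝ)| ≤ b v := by
        refine le_trans (abs_le.2 ⟨?_, ?_⟩) (Int.le_ceil _)
        · have := neg_abs_le (extendZero (S := S) θ v)
          linarith
        · have := le_abs_self (extendZero (S := S) θ v)
          linarith
      exact_mod_cast h3
    have hI : ∀ i, |I i| ≤ B := by
      intro i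
      refine (IsAcyclic.abs_le _ h.acyclic i).trans (Finset.sum_le_sum fun v _ => ?_)
      rw [h.div_eq, Pi.sub_apply]
      exact (abs_sub _ _).trans (add_le_add le_rfl (hD v))
    exact ⟨fun i => (abs_le.1 (hI i)).1, fun i => (abs_le.1 (hI i)).2⟩
  refine (Set.finite_iUnion fun S => (hflow S).image (F S)).subset ?_
  rintro C ⟨S, D, I, h, rfl⟩
  exact Set.mem_iUnion.2 ⟨S, I, ⟨D, h⟩, rfl⟩

end Lengths

end Multigraph

/-! ### Existence: minimizing a convex energy -/

/-- The continuous function that equals `x ^ 2 / 2` at the integers and is affine in between. -/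
noncomputable def interpolatedSquare (x : ℝ) : ℝ :=
  x ^ 2 / 2 + Int.fract x * (1 - Int.fract x) / 2

theorem continuous_interpolatedSquare : Continuous interpolatedSquare := by
  have h : Continuous ((fun y : ℝ => y * (1 - y) / 2) ∘ Int.fract) :=
    ContinuousOn.comp_fract'' (by fun_prop) (by norm_num)
  exact (by fun_prop : Continuous fun x : ℝ => x ^ 2 / 2).add h

theorem sq_div_two_le_interpolatedSquare (x : ℝ) : x ^ 2 / 2 ≤ interpolatedSquare x := by
  have h1 := Int.fract_nonneg x
  have h2 := (Int.fract_lt_one x).le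
  have : 0 ≤ Int.fract x * (1 - Int.fract x) := mul_nonneg h1 (by linarith)
  unfold interpolatedSquare
  linarith

theorem interpolatedSquare_eq {n : ℤ} {x : ℝ} (h1 : (n : ℝ) ≤ x) (h2 : x ≤ n + 1) :
    interpolatedSquare x = (n + 1 / 2) * x - n * (n + 1) / 2 := by
  rcases h2.eq_or_lt with h | h
  · have hf : Int.fract x = 0 := by
      rw [h]
      exact_mod_cast Int.fract_intCast (R := ℝ) (n + 1)
    rw [interpolatedSquare, hf, h]
    ring
  · have hf : Int.fract x = x - n := by
      rw [Int.fract, Int.floor_eq_iff.2 ⟨h1, h⟩]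
    rw [interpolatedSquare, hf]
    ring

/-- To the right of `x` the slope is `⌊x⌋ + 1/2`, to the left `⌈x⌉ - 1/2`. These half-integers are
the ones occurring in the cut terms, and the kink at integers is why minimality yields only
inequalities. -/
theorem interpolatedSquare_add {x s : ℝ} (h0 : 0 ≤ s) (h : s ≤ ⌊x⌋ + 1 - x) :
    interpolatedSquare (x + s) - interpolatedSquare x = s * (⌊x⌋ + 1 / 2) := by
  have h1 := Int.floor_le x
  have h2 := Int.lt_floor_add_one x
  rw [interpolatedSquare_eq (n := ⌊x⌋) (by linarith) (by linarith),
    interpolatedSquare_eq (n := ⌊x⌋) h1 h2.le]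
  ring

theorem interpolatedSquare_sub {x s : ℝ} (h0 : 0 ≤ s) (h : s ≤ x - ⌈x⌉ + 1) :
    interpolatedSquare (x - s) - interpolatedSquare x = -s * (⌈x⌉ - 1 / 2) := by
  have h1 := Int.le_ceil x
  have h2 := Int.ceil_lt_add_one x
  rw [interpolatedSquare_eq (n := ⌈x⌉ - 1) (by push_cast; linarith) (by push_cast; linarith),
    interpolatedSquare_eq (n := ⌈x⌉ - 1) (by push_cast; linarith) (by push_cast; linarith)]
  push_cast
  ring

/-- The energy of a function on the edges, with linear term `η`, has a minimum on every linear
subspace. -/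
theorem exists_min_energy {E : Type*} [Fintype E] {x : E → ℝ} (hx : ∀ e, 0 < x e) (η : E → ℝ)
    (W : Submodule ℝ (E → ℝ)) :
    ∃ y ∈ W, ∀ z ∈ W, ∑ e, (x e * interpolatedSquare (y e / x e) - η e * y e) ≤
      ∑ e, (x e * interpolatedSquare (z e / x e) - η e * z e) := by
  set F : (E → ℝ) → ℝ := fun z => ∑ e, (x e * interpolatedSquare (z e / x e) - η e * z e)
  have hF : Continuous F := by
    refine continuous_finsetSum _ fun e _ => ?_
    have : Continuous fun z : E → ℝ => interpolatedSquare (z e / x e) :=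
      continuous_interpolatedSquare.comp (by fun_prop)
    fun_prop
  have hF0 : F 0 = 0 := by simp [F, interpolatedSquare]
  -- Completing the square bounds each summand from below by a quadratic, so the sublevel set at the
  -- value of the zero function is compact.
  have hlow : ∀ (z : E → ℝ) (e : E), (z e - η e * x e) ^ 2 / (2 * x e) ≤
      (x e * interpolatedSquare (z e / x e) - η e * z e) + η e ^ 2 * x e / 2 := by
    intro z e
    have h := mul_le_mul_of_nonneg_left (sq_div_two_le_interpolatedSquare (z e / x e)) (hx e).le
    have h' : (z e - η e * x e) ^ 2 / (2 * x e) =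
        x e * ((z e / x e) ^ 2 / 2) - η e * z e + η e ^ 2 * x e / 2 := by
      have := (hx e).ne'
      field_simp
      ring
    linarith
  set c : ℝ := ∑ e, η e ^ 2 * x e / 2
  set K : Set (E → ℝ) := W ∩ {z | F z ≤ 0}
  have hK : IsCompact K := by
    refine (isCompact_Icc (a := fun e => η e * x e - √(2 * x e * c))
      (b := fun e => η e * x e + √(2 * x e * c))).of_isClosed_subset
      (W.closed_of_finiteDimensional.inter (isClosed_le hF continuous_const)) ?_
    rintro z ⟨-, hz⟩
    have hb : ∀ e, |z e - η e * x e| ≤ √(2 * x e * c) := by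
      intro e
      refine Real.abs_le_sqrt ?_
      have h1 : (z e - η e * x e) ^ 2 / (2 * x e) ≤ ∑ e, (z e - η e * x e) ^ 2 / (2 * x e) :=
        Finset.single_le_sum (f := fun e => (z e - η e * x e) ^ 2 / (2 * x e))
          (fun e _ => div_nonneg (sq_nonneg _) (by have := hx e; linarith)) (Finset.mem_univ e)
      have h2 : ∑ e, (z e - η e * x e) ^ 2 / (2 * x e) ≤ F z + c := by
        rw [← Finset.sum_add_distrib]
        exact Finset.sum_le_sum fun e _ => hlow z e
      have h3 : F z ≤ 0 := hz
      have h4 := (div_le_iff₀ (by have := hx e; linarith : 0 < 2 * x e)).1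
        (h1.trans (h2.trans (by linarith : F z + c ≤ c)))
      linarith
    constructor
    · intro e
      have := (abs_le.1 (hb e)).1
      linarith
    · intro e
      have := (abs_le.1 (hb e)).2
      linarith
  obtain ⟨y, hy, hmin⟩ := hK.exists_isMinOn ⟨0, W.zero_mem, hF0.le⟩ hF.continuousOn
  refine ⟨y, hy.1, fun z hz => ?_⟩
  by_cases h : F z ≤ 0
  · exact hmin ⟨hz, h⟩
  · exact le_trans hy.2 (not_le.1 h).le

namespace Multigraph

variable {V E : Type*} {Γ : Multigraph V E}

/-- The difference of a function on the vertices along the edges. -/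
def coboundary (Γ : Multigraph V E) : (V → ℝ) →ₗ[ℝ] (E → ℝ) where
  toFun φ e := φ (Γ.tgt e) - φ (Γ.src e)
  map_add' φ ψ := by
    funext e
    simp only [Pi.add_apply]
    ring
  map_smul' c φ := by
    funext e
    simp only [Pi.smul_apply, smul_eq_mul, RingHom.id_apply]
    ring

theorem coboundary_apply (φ : V → ℝ) (e : E) :
    Γ.coboundary φ e = φ (Γ.tgt e) - φ (Γ.src e) := rfl

variable [Fintype V] [DecidableEq V] [Fintype E]

/-- A functional of total weight zero on the vertices factors through the coboundary. -/
theorem Connected.exists_sum_mul_coboundary (hΓ : Γ.Connected) {c : V → ℝ} (hc : ∑ v, c v = 0) :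
    ∃ η : E → ℝ, ∀ φ, ∑ e, η e * Γ.coboundary φ e = ∑ v, c v * φ v := by
  obtain ⟨⟨v₀⟩, hconn⟩ := hΓ
  choose p hp using fun v => Γ.exists_flow_of_eqvGen v₀ v (hconn v₀ v)
  -- Superpose unit flows from `v₀` to `v` with weights `c v`; the contribution of `v₀` vanishes
  -- since the weights sum to zero.
  refine ⟨fun e => ∑ v, c v * p v e, fun φ => ?_⟩
  have h1 : ∀ v, ∑ e, (p v e : ℝ) * Γ.coboundary φ e = φ v - φ v₀ := by
    intro v
    have h := Γ.sum_mul_div (p v) φ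
    simp only [coboundary_apply]
    rw [← h, hp]
    simp [mul_sub, Finset.sum_sub_distrib, Pi.single_apply]
  calc ∑ e, (∑ v, c v * p v e) * Γ.coboundary φ e
      = ∑ v, c v * ∑ e, (p v e : ℝ) * Γ.coboundary φ e := by
        simp only [Finset.sum_mul, Finset.mul_sum]
        rw [Finset.sum_comm]
        exact Finset.sum_congr rfl fun v _ => Finset.sum_congr rfl fun e _ => by ring
    _ = ∑ v, c v * φ v := by
        simp only [h1, mul_sub, Finset.sum_sub_distrib, ← Finset.sum_mul, hc, zero_mul, sub_zero]

/-- A potential whose slopes satisfy the cut inequalities. -/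
theorem Connected.exists_potential (hΓ : Γ.Connected) {c : V → ℝ} (hc : ∑ v, c v = 0) {x : E → ℝ}
    (hx : ∀ e, 0 < x e) : ∃ φ : V → ℝ, ∀ G : Finset V,
      ∑ e, (if Γ.tgt e ∈ G then
          (if Γ.src e ∈ G then 0 else (⌈Γ.coboundary φ e / x e⌉ : ℝ) - 1 / 2)
        else (if Γ.src e ∈ G then -(⌊Γ.coboundary φ e / x e⌋ : ℝ) - 1 / 2 else 0)) ≤
      ∑ v ∈ G, c v := by
  obtain ⟨η, hη⟩ := hΓ.exists_sum_mul_coboundary hc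
  -- Minimizing over coboundaries rather than potentials removes the constants, along which the
  -- energy does not grow.
  obtain ⟨_, ⟨φ, rfl⟩, hmin⟩ := exists_min_energy hx η (LinearMap.range Γ.coboundary)
  refine ⟨φ, fun G => ?_⟩
  set u : E → ℝ := fun e => Γ.coboundary φ e / x e
  -- For small `s` no slope crosses an integer when the potential is lowered by `s` on `G`, so every
  -- summand changes affinely.
  have hsmall : ∀ᶠ s : ℝ in nhdsWithin 0 (Set.Ioi 0), ∀ e,
      s / x e ≤ ⌊u e⌋ + 1 - u e ∧ s / x e ≤ u e - ⌈u e⌉ + 1 := by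
    refine Filter.eventually_all.2 fun e => ?_
    have h1 := Int.lt_floor_add_one (u e)
    have h2 := Int.ceil_lt_add_one (u e)
    have h3 : 0 < min (⌊u e⌋ + 1 - u e) (u e - ⌈u e⌉ + 1) * x e :=
      mul_pos (lt_min (by linarith) (by linarith)) (hx e)
    filter_upwards [nhdsWithin_le_nhds (eventually_lt_nhds h3)] with s hs
    exact le_min_iff.1 ((div_le_iff₀ (hx e)).2 hs.le)
  obtain ⟨s, hs', hs0⟩ := (hsmall.and self_mem_nhdsWithin).exists
  have hs0 : 0 < s := hs0
  set χ : V → ℝ := fun v => if v ∈ G then 1 else 0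
  have hle := hmin _ ⟨φ - s • χ, rfl⟩
  have hη' := hη (φ - s • χ)
  have hηφ := hη φ
  simp only [Finset.sum_sub_distrib] at hle
  rw [hη', hηφ] at hle
  have hχ : ∑ v, c v * (φ - s • χ) v = ∑ v, c v * φ v - s * ∑ v ∈ G, c v := by
    simp only [Pi.sub_apply, Pi.smul_apply, smul_eq_mul, mul_sub, Finset.sum_sub_distrib, χ,
      mul_ite, mul_one, mul_zero, Finset.sum_ite_mem, Finset.univ_inter, Finset.mul_sum]
    congr 1
    exact Finset.sum_congr rfl fun v _ => mul_comm _ _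
  rw [hχ] at hle
  have hterm : ∀ e, x e * interpolatedSquare (Γ.coboundary (φ - s • χ) e / x e) -
      x e * interpolatedSquare (Γ.coboundary φ e / x e) =
      -s * (if Γ.tgt e ∈ G then (if Γ.src e ∈ G then 0 else (⌈u e⌉ : ℝ) - 1 / 2)
        else (if Γ.src e ∈ G then -(⌊u e⌋ : ℝ) - 1 / 2 else 0)) := by
    intro e
    have hxe := (hx e).ne'
    have hsx : 0 ≤ s / x e := div_nonneg hs0.le (hx e).le
    have hd : Γ.coboundary (φ - s • χ) e / x e =
        u e - s / x e * (χ (Γ.tgt e) - χ (Γ.src e)) := by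
      simp only [u, map_sub, map_smul, Pi.sub_apply, Pi.smul_apply, smul_eq_mul]
      rw [← coboundary_apply χ]
      field_simp
    rw [hd, ← mul_sub]
    change x e * (_ - interpolatedSquare (u e)) = _
    by_cases ht : Γ.tgt e ∈ G <;> by_cases hs : Γ.src e ∈ G
    · simp [χ, ht, hs]
    · simp only [χ, ht, hs, if_true, if_false, sub_zero, mul_one]
      rw [interpolatedSquare_sub hsx (hs' e).2]
      field_simp
    · simp only [χ, ht, hs, if_true, if_false, zero_sub, mul_neg, mul_one, sub_neg_eq_add]
      rw [interpolatedSquare_add hsx (hs' e).1]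
      field_simp
      ring
    · simp [χ, ht, hs]
  have hsum := Finset.sum_congr rfl fun e (_ : e ∈ Finset.univ) => hterm e
  rw [Finset.sum_sub_distrib, ← Finset.mul_sum] at hsum
  refine le_of_mul_le_mul_left ?_ hs0
  linarith

variable [DecidableEq E]

/-- Round the slopes of the minimizing potential: edges with non-integral slope are subdivided into
pieces of slopes `⌊u⌋` and `⌊u⌋ + 1`, and `D` is defined by the divisor equation. All pieces have
positive length, so the potential forces acyclicity. -/
theorem exists_isTriple_of_pos (hΓ : Γ.Connected) {θ : V → ℝ} (hθ : Γ.IsNondegenerate θ) {δ : V → ℤ}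
    (hdeg : ∑ v, θ v = ((∑ v, δ v : ℤ) : ℝ)) {x : E → ℝ} (hx : ∀ e, 0 < x e) :
    ∃ S D I, Γ.IsTriple θ δ S D I ∧ x ∈ Γ.sigmaOrthant S I := by
  obtain ⟨φ, hφ⟩ := hΓ.exists_potential (c := fun v => (δ v : ℝ) - θ v)
    (by rw [Finset.sum_sub_distrib, hdeg]; push_cast; ring) hx
  set u : E → ℝ := fun e => Γ.coboundary φ e / x e
  set S : Finset E := Finset.univ.filter fun e => (⌊u e⌋ : ℝ) ≠ u e
  have hS : ∀ e, e ∈ S ↔ (⌊u e⌋ : ℝ) ≠ u e := fun e => by simp [S]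
  set I : GraphFlow (E ⊕ {e // e ∈ S}) := Sum.elim (fun e => ⌊u e⌋) fun y => ⌊u y.1⌋ + 1
  set D : V ⊕ {e // e ∈ S} → ℤ := extendZero δ - (Γ.subdivide S).div I
  have hdiv : (Γ.subdivide S).div I = extendZero δ - D := by simp [D]
  have hjump : ∀ y : {e // e ∈ S}, I (Sum.inr y) = I (Sum.inl y.1) + 1 := fun y => rfl
  have hadm : IsAdmissible D := by
    intro y
    simp only [D, Pi.sub_apply, subdivide_div_inr, hjump, extendZero, Sum.elim_inr]
    ring
  have hlast : ∀ e, lastValue I e = ⌈u e⌉ := by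
    intro e
    have h1 := Int.floor_le (u e)
    have h2 := Int.lt_floor_add_one (u e)
    by_cases he : e ∈ S
    · simp only [lastValue, he, dif_pos, I, Sum.elim_inr]
      have h3 := lt_of_le_of_ne h1 ((hS e).1 he)
      exact (Int.ceil_eq_iff.2 ⟨by push_cast; linarith, by push_cast; linarith⟩).symm
    · simp only [lastValue, he, dif_neg, not_false_eq_true, I, Sum.elim_inl]
      have h3 : (⌊u e⌋ : ℝ) = u e := by
        by_contra hne
        exact he ((hS e).2 hne)
      conv_rhs => rw [← h3]
      rw [Int.ceil_intCast]
  have hsemi : Γ.IsSemistable θ S D := by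
    refine Γ.isSemistable_of_sum_cutTerm_le hadm hdiv hdeg fun G => ?_
    have h := hφ G
    rw [Finset.sum_sub_distrib] at h
    push_cast
    refine le_trans (le_of_eq (Finset.sum_congr rfl fun e _ => ?_)) h
    simp only [cutTerm, hlast]
    rfl
  set t : E → ℝ := fun e => x e * Int.fract (u e)
  have ht0 : ∀ e ∉ S, t e = 0 := by
    intro e he
    have : (⌊u e⌋ : ℝ) = u e := by
      by_contra hne
      exact he ((hS e).2 hne)
    simp only [t, ← Int.self_sub_floor, this, sub_self, mul_zero]
  have hslope : ∀ e, φ (Γ.tgt e) - φ (Γ.src e) = x e * I (Sum.inl e) + t e := by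
    intro e
    have h1 : x e * u e = φ (Γ.tgt e) - φ (Γ.src e) := mul_div_cancel₀ _ (hx e).ne'
    rw [← h1]
    simp only [I, t, Sum.elim_inl]
    rw [← mul_add, Int.floor_add_fract]
  refine ⟨S, D, I, ⟨hθ S D hsemi, ?_, hdiv⟩, ?_⟩
  · refine (Γ.subdivide S).isAcyclic_of_potential (len := Sum.elim (fun e => x e - t e)
      fun y => t y.1) ?_ (extend_potential hjump ht0 hslope)
    rintro (e | y)
    · have := mul_lt_mul_of_pos_left (Int.fract_lt_one (u e)) (hx e)
      simp only [Sum.elim_inl, t]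
      linarith
    · refine mul_pos (hx y.1) (lt_of_le_of_ne (Int.fract_nonneg _) fun h => ?_)
      have h1 := (hS y.1).1 y.2
      have h2 := Int.self_sub_floor (u y.1)
      rw [← h] at h2
      exact h1 (by linarith)
  · refine (mem_sigmaOrthant_iff hΓ hjump).2 ⟨φ, t, fun e => ⟨?_, ?_, ht0 e, hslope e⟩⟩
    · exact mul_nonneg (hx e).le (Int.fract_nonneg _)
    · exact mul_le_of_le_one_right (hx e).le (Int.fract_lt_one _).le

theorem IsTriple.nonneg_of_mem (hΓ : Γ.Connected) {θ : V → ℝ} {δ : V → ℤ} {S : Finset E}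
    {D : V ⊕ {e // e ∈ S} → ℤ} {I : GraphFlow (E ⊕ {e // e ∈ S})} (h : Γ.IsTriple θ δ S D I)
    {x : E → ℝ} (hx : x ∈ Γ.sigmaOrthant S I) (e : E) : 0 ≤ x e := by
  obtain ⟨φ, t, ht⟩ := (mem_sigmaOrthant_iff hΓ h.inr_eq).1 hx
  exact (ht e).1.trans (ht e).2.1

/-- All edge lengths lie in the cone of some triple. -/
theorem exists_isTriple (hΓ : Γ.Connected) {θ : V → ℝ} (hθ : Γ.IsNondegenerate θ) {δ : V → ℤ}
    (hdeg : ∑ v, θ v = ((∑ v, δ v : ℤ) : ℝ)) {x : E → ℝ} (hx : ∀ e, 0 ≤ x e) :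
    ∃ S D I, Γ.IsTriple θ δ S D I ∧ x ∈ Γ.sigmaOrthant S I := by
  set K : Set (PointedCone ℝ (E → ℝ)) :=
    {C | ∃ S D I, Γ.IsTriple θ δ S D I ∧ C = Γ.sigmaOrthant S I}
  have hclosed : IsClosed (⋃ C ∈ K, (C : Set (E → ℝ))) := by
    refine (finite_setOf_isTriple Γ θ δ Γ.sigmaOrthant).isClosed_biUnion ?_
    rintro C ⟨S, D, I, h, rfl⟩
    exact h.isClosed_sigmaOrthant hΓ hdeg
  -- Lengths that may vanish are approached by strictly positive ones.
  have hlim : Filter.Tendsto (fun s : ℝ => x + s • (1 : E → ℝ)) (nhdsWithin 0 (Set.Ioi 0))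
      (nhds x) := by
    have h : Continuous fun s : ℝ => x + s • (1 : E → ℝ) := by fun_prop
    have h' := h.tendsto 0
    simp only [zero_smul, add_zero] at h'
    exact h'.mono_left nhdsWithin_le_nhds
  have hmem : x ∈ ⋃ C ∈ K, (C : Set (E → ℝ)) := by
    refine hclosed.mem_of_tendsto hlim ?_
    filter_upwards [self_mem_nhdsWithin] with s hs
    obtain ⟨S, D, I, h, hxs⟩ := exists_isTriple_of_pos hΓ hθ hdeg (x := x + s • (1 : E → ℝ))
      fun e => by
        have h1 : 0 < s := hs
        have h2 := hx e
        simp only [Pi.add_apply, Pi.smul_apply, Pi.one_apply, smul_eq_mul, mul_one]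
        linarith
    exact Set.mem_biUnion (show Γ.sigmaOrthant S I ∈ K from ⟨S, D, I, h, rfl⟩) hxs
  obtain ⟨C, ⟨S, D, I, h, rfl⟩, hxC⟩ := Set.mem_iUnion₂.1 hmem
  exact ⟨S, D, I, h, hxC⟩

end Multigraph

/-! ### Rationality of the cones -/

namespace Multigraph

variable {V E : Type*} [DecidableEq V] [Fintype E] [DecidableEq E] (Γ : Multigraph V E)

theorem mem_tauOrthant_iff_sum {S : Finset E} {I : GraphFlow (E ⊕ {e // e ∈ S})}
    {len : E ⊕ {e // e ∈ S} → ℝ} : len ∈ Γ.tauOrthant S I ↔ (∀ i, 0 ≤ len i) ∧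
      ∀ γ ∈ (Γ.subdivide S).H1, ∑ i, ((γ i * I i : ℤ) : ℝ) * len i = 0 := by
  refine and_congr Iff.rfl (forall₂_congr fun γ _ => ?_)
  rw [GraphFlow.pairing_eq_sum]
  refine Eq.congr (Finset.sum_congr rfl fun i _ => ?_) rfl
  push_cast
  ring

theorem isRationalPolyhedral_sigmaOrthant (S : Finset E) (I : GraphFlow (E ⊕ {e // e ∈ S})) :
    IsRationalPolyhedral (latticeFun E) (Γ.sigmaOrthant S I) := by
  refine IsRationalPolyhedral.map (L := latticeFun _) ?_ _ fun x hx => prLen_mem_latticeFun hx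
  refine isRationalPolyhedral_of_equations
    {a | ∃ γ ∈ (Γ.subdivide S).H1, a = fun i => γ i * I i} fun x => ?_
  rw [mem_tauOrthant_iff_sum]
  refine and_congr_right fun _ => ⟨?_, fun h γ hγ => h _ ⟨γ, hγ, rfl⟩⟩
  rintro h _ ⟨γ, hγ, rfl⟩
  exact h γ hγ

variable {P : Type*} [AddCommMonoid P]

/-- A function on generators of a monoid that respects all relations extends to a homomorphism. -/
theorem exists_addMonoidHom_of_relations {ι : Type*} [Fintype ι] {g : ι → P}
    (hg : ∀ q, ∃ a : ι → ℕ, q = ∑ i, a i • g i) {x : ι → ℝ}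
    (hx : ∀ a b : ι → ℕ, ∑ i, a i • g i = ∑ i, b i • g i →
      ∑ i, (a i : ℝ) * x i = ∑ i, (b i : ℝ) * x i) :
    ∃ p : P →+ ℝ, ∀ a : ι → ℕ, p (∑ i, a i • g i) = ∑ i, (a i : ℝ) * x i := by
  choose c hc using hg
  refine ⟨{ toFun := fun q => ∑ i, (c q i : ℝ) * x i, map_zero' := ?_, map_add' := ?_ },
    fun a => ?_⟩
  · rw [hx (c 0) 0 (by rw [← hc]; simp)]
    simp
  · intro q r
    rw [hx (c (q + r)) (c q + c r) (by
      rw [← hc]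
      simp only [Pi.add_apply, add_smul, Finset.sum_add_distrib]
      rw [← hc, ← hc])]
    simp [add_mul, Finset.sum_add_distrib]
  · exact hx _ _ (hc _).symm

/-- Evaluation on generators of `P` embeds pairs `(p, len)` in a coordinate space, where lattice
points can be recognized and the cone upstairs becomes an orthant cut by integral equations. -/
theorem isRationalPolyhedral_sigma (hP : AddMonoid.FG P) (ℓ : E → P) (S : Finset E)
    (I : GraphFlow (E ⊕ {e // e ∈ S})) : IsRationalPolyhedral (latticeHom P) (Γ.sigma ℓ S I) := by
  classical
  obtain ⟨s, hs⟩ := hP.fg_top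
  have hgen : ∀ q : P, ∃ a : s → ℕ, q = ∑ i, a i • (i : P) := fun q =>
    AddSubmonoid.mem_closure_finset'.1 (hs ▸ AddSubmonoid.mem_top q)
  choose c hc using fun e => hgen (ℓ e)
  have hext : ∀ (p : P →+ ℝ) (a : s → ℕ),
      p (∑ i, a i • (i : P)) = ∑ i, (a i : ℝ) * p i := by
    intro p a
    simp [map_sum]
  set J : (P →+ ℝ) × (E ⊕ {e // e ∈ S} → ℝ) →ₗ[ℝ] (s ⊕ (E ⊕ {e // e ∈ S}) → ℝ) :=
    { toFun := fun x => Sum.elim (fun i => x.1 i) x.2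
      map_add' := fun x y => by funext i; rcases i with i | i <;> rfl
      map_smul' := fun r x => by funext i; rcases i with i | i <;> rfl }
  have hJl : ∀ x i, J x (Sum.inl i) = x.1 i := fun x i => rfl
  have hJinj : Function.Injective J := by
    intro x y hxy
    refine Prod.ext (AddMonoidHom.ext fun q => ?_) (funext fun i => congrFun hxy (Sum.inr i))
    obtain ⟨a, rfl⟩ := hgen q
    rw [hext, hext]
    exact Finset.sum_congr rfl fun i _ => by rw [← hJl, ← hJl, hxy]
  have hJL : ∀ x, J x ∈ latticeFun _ → x ∈ (latticeHom P).prod (latticeFun _) := by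
    intro x hx
    refine ⟨fun q => ?_, fun i => hx (Sum.inr i)⟩
    obtain ⟨a, rfl⟩ := hgen q
    choose z hz using fun i => hx (Sum.inl i)
    refine ⟨∑ i, a i * z i, ?_⟩
    rw [hext]
    push_cast
    exact Finset.sum_congr rfl fun i _ => by rw [← hz, hJl]
  refine IsRationalPolyhedral.map (L := (latticeHom P).prod (latticeFun _)) ?_ _ fun x hx => hx.1
  refine IsRationalPolyhedral.of_map hJinj (fun x _ hx => hJL x hx) ?_
  -- Three families of equations: relations among the generators, compatibility of `ℓ e` with the
  -- parts of `e`, and orthogonality of `I` to homology.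
  refine isRationalPolyhedral_of_equations
    ({r | ∃ a b : s → ℕ, ∑ i, a i • (i : P) = ∑ i, b i • (i : P) ∧
        r = Sum.elim (fun i => (a i : ℤ) - b i) 0} ∪
      {r | ∃ e, r = Sum.elim (fun i => -(c e i : ℤ)) (Sum.elim (Pi.single e 1)
        fun y => if y.1 = e then 1 else 0)} ∪
      {r | ∃ γ ∈ (Γ.subdivide S).H1, r = Sum.elim (fun _ => 0) fun i => γ i * I i}) fun y => ?_
  have hpr : ∀ (e : E) (len : E ⊕ {e // e ∈ S} → ℝ), prLen S len e =
      ∑ f, (((Pi.single e 1 : E → ℤ) f : ℤ) : ℝ) * len (Sum.inl f) +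
        ∑ y : {e // e ∈ S}, ((if y.1 = e then 1 else 0 : ℤ) : ℝ) * len (Sum.inr y) := by
    intro e len
    rw [Finset.sum_eq_single e (fun b _ hb => by simp [hb]) (by simp)]
    by_cases hS : e ∈ S
    · rw [Finset.sum_eq_single ⟨e, hS⟩, prLen_apply_of_mem _ hS]
      · simp
      · intro y _ hy
        have : y.1 ≠ e := fun h => hy (Subtype.ext h)
        simp [this]
      · simp
    · rw [Finset.sum_eq_zero, prLen_apply_of_notMem _ hS]
      · simp
      · intro y _
        have : y.1 ≠ e := fun h => hS (h ▸ y.2)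
        simp [this]
  constructor
  · rintro ⟨x, ⟨⟨h1, h2, h3⟩, h4⟩, rfl⟩
    refine ⟨?_, ?_⟩
    · rintro (i | i)
      · exact h1 i
      · exact h2 i
    · intro r hr
      change ∑ i, (r i : ℝ) *
        (Sum.elim (fun i : s => x.1 i) x.2 : s ⊕ (E ⊕ {e // e ∈ S}) → ℝ) i = 0
      rcases hr with (⟨a, b, hab, rfl⟩ | ⟨e, rfl⟩) | ⟨γ, hγ, rfl⟩
      · have h5 := congrArg x.1 hab
        rw [hext, hext] at h5
        simp only [Fintype.sum_sum_type, Sum.elim_inl, Sum.elim_inr, Pi.zero_apply,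
          Int.cast_zero, zero_mul, Finset.sum_const_zero, add_zero]
        push_cast
        simp only [sub_mul, Finset.sum_sub_distrib]
        linarith
      · have h5 := congrFun h3 e
        rw [hpr, hc e, hext] at h5
        rw [Fintype.sum_sum_type, Fintype.sum_sum_type]
        simp only [Sum.elim_inl, Sum.elim_inr, Int.cast_neg, neg_mul,
          Finset.sum_neg_distrib, Int.cast_natCast]
        linarith
      · have h5 := ((Γ.mem_tauOrthant_iff_sum).1 h4).2 γ hγ
        rw [Fintype.sum_sum_type]
        simp only [Sum.elim_inl, Sum.elim_inr, Int.cast_zero, zero_mul,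
          Finset.sum_const_zero, zero_add]
        exact h5
  · rintro ⟨h1, h2⟩
    obtain ⟨p, hp⟩ := exists_addMonoidHom_of_relations (g := fun i : s => (i : P)) hgen
      (x := fun i => y (Sum.inl i)) fun a b hab => by
        have h3 := h2 _ (Or.inl (Or.inl ⟨a, b, hab, rfl⟩))
        simp only [Fintype.sum_sum_type, Sum.elim_inl, Sum.elim_inr, Pi.zero_apply,
          Int.cast_zero, zero_mul, Finset.sum_const_zero, add_zero] at h3
        push_cast at h3
        simp only [sub_mul, Finset.sum_sub_distrib] at h3
        linarith
    have hpi : ∀ i : s, p i = y (Sum.inl i) := by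
      intro i
      have h3 := hp (Pi.single i 1)
      rw [Finset.sum_eq_single i (fun b _ hb => by simp [hb]) (by simp),
        Finset.sum_eq_single i (fun b _ hb => by simp [hb]) (by simp)] at h3
      simpa using h3
    refine ⟨(p, fun i => y (Sum.inr i)), ⟨⟨fun q => ?_, fun i => h1 _, funext fun e => ?_⟩, ?_⟩, ?_⟩
    · obtain ⟨a, rfl⟩ := hgen q
      change 0 ≤ p _
      rw [hp]
      exact Finset.sum_nonneg fun i _ => mul_nonneg (Nat.cast_nonneg _) (h1 _)
    · have h3 := h2 _ (Or.inl (Or.inr ⟨e, rfl⟩))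
      rw [Fintype.sum_sum_type, Fintype.sum_sum_type] at h3
      simp only [Sum.elim_inl, Sum.elim_inr, Int.cast_neg, neg_mul,
        Finset.sum_neg_distrib, Int.cast_natCast] at h3
      rw [hpr]
      change _ = p (ℓ e)
      rw [hc e, hp]
      linarith
    · refine (Γ.mem_tauOrthant_iff_sum).2 ⟨fun i => h1 _, fun γ hγ => ?_⟩
      have h3 := h2 _ (Or.inr ⟨γ, hγ, rfl⟩)
      rw [Fintype.sum_sum_type] at h3
      simp only [Sum.elim_inl, Sum.elim_inr, Int.cast_zero, zero_mul,
        Finset.sum_const_zero, zero_add] at h3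
      exact h3
    · funext i
      rcases i with i | i
      · exact hpi i
      · rfl

end Multigraph

/-! ### The fans -/

namespace Multigraph

variable {V E : Type*} [Fintype V] [DecidableEq V] [Fintype E]

theorem sum_numHalfEdges (Γ : Multigraph V E) {n : ℕ} (leg : Fin n → V) :
    ∑ v, Γ.numHalfEdges leg v = 2 * Fintype.card E + n := by
  simp only [numHalfEdges, Finset.sum_add_distrib]
  rw [← Finset.card_eq_sum_card_fiberwise (fun _ _ => Finset.mem_coe.2 (Finset.mem_univ _)),
    ← Finset.card_eq_sum_card_fiberwise (fun _ _ => Finset.mem_coe.2 (Finset.mem_univ _))]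
  simp [mul_comm]

/-- Counting half-edges and using the genus formula, the log canonical degrees add up to `2g - 2 +
n`. -/
theorem IsStableGraph.sum_degKA {Γ : Multigraph V E} {g n : ℕ} {gen : V → ℕ} {leg : Fin n → V}
    (h : Γ.IsStableGraph g n gen leg) (k : ℤ) (A : Fin n → ℤ)
    (hA : ∑ i, A i = k * (2 * (g : ℤ) - 2 + n)) : ∑ v, Γ.degKA gen leg k A v = 0 := by
  have h1 : ∑ v, ∑ i with leg i = v, A i = ∑ i, A i :=
    Finset.sum_fiberwise Finset.univ leg A
  have h2 : ∑ v, (2 * (gen v : ℤ) - 2 + Γ.numHalfEdges leg v) = 2 * (g : ℤ) - 2 + n := by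
    have h3 := congrArg (Nat.cast (R := ℤ)) (Γ.sum_numHalfEdges leg)
    have h4 := congrArg (Nat.cast (R := ℤ)) h.genus_eq
    push_cast at h3 h4
    simp only [Finset.sum_add_distrib, Finset.sum_sub_distrib, ← Finset.mul_sum, h3,
      Finset.sum_const, Finset.card_univ, nsmul_eq_mul]
    linarith
  simp only [degKA, Finset.sum_sub_distrib, ← Finset.mul_sum, h1, h2, hA, sub_self]

variable [DecidableEq E] {Γ : Multigraph V E}

theorem isFan_orthant (hΓ : Γ.Connected) {θ : V → ℝ} {δ : V → ℤ}
    (hdeg : ∑ v, θ v = ((∑ v, δ v : ℤ) : ℝ)) :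
    IsFan (latticeFun E)
      (withFaces {C | ∃ S D I, Γ.IsTriple θ δ S D I ∧ C = Γ.sigmaOrthant S I}) := by
  refine isFan_withFaces (finite_setOf_isTriple Γ θ δ Γ.sigmaOrthant) ?_ ?_ ?_
  · rintro C ⟨S, D, I, h, rfl⟩
    exact Γ.isRationalPolyhedral_sigmaOrthant S I
  · rintro C ⟨S, D, I, h, rfl⟩ x hx hx'
    funext e
    have h1 := h.nonneg_of_mem hΓ hx e
    have h2 := h.nonneg_of_mem hΓ hx' e
    exact le_antisymm (neg_nonneg.1 h2) h1
  · rintro C₁ ⟨S, D, I, h, rfl⟩ C₂ ⟨S', D', I', h', rfl⟩ x hx y hy hxy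
    exact h.mem_sigmaOrthant_of_add_mem hΓ h' hdeg hx hy hxy

theorem fanSupport_orthant (hΓ : Γ.Connected) {θ : V → ℝ} (hθ : Γ.IsNondegenerate θ) {δ : V → ℤ}
    (hdeg : ∑ v, θ v = ((∑ v, δ v : ℤ) : ℝ)) :
    fanSupport (withFaces {C | ∃ S D I, Γ.IsTriple θ δ S D I ∧ C = Γ.sigmaOrthant S I}) =
      (orthant E : Set (E → ℝ)) := by
  rw [fanSupport_withFaces]
  ext x
  constructor
  · rintro ⟨C, ⟨S, D, I, h, rfl⟩, hx⟩
    exact fun e => h.nonneg_of_mem hΓ hx e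
  · intro hx
    obtain ⟨S, D, I, h, hxC⟩ := exists_isTriple hΓ hθ hdeg hx
    exact ⟨_, ⟨S, D, I, h, rfl⟩, hxC⟩

variable {P : Type*} [AddCommMonoid P]

theorem isFan_sigma (hP : AddMonoid.FG P) (ℓ : E → P) (hΓ : Γ.Connected) {θ : V → ℝ} {δ : V → ℤ}
    (hdeg : ∑ v, θ v = ((∑ v, δ v : ℤ) : ℝ)) :
    IsFan (latticeHom P) (withFaces {C | ∃ S D I, Γ.IsTriple θ δ S D I ∧ C = Γ.sigma ℓ S I}) := by
  refine isFan_withFaces (finite_setOf_isTriple Γ θ δ (Γ.sigma ℓ)) ?_ ?_ ?_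
  · rintro C ⟨S, D, I, h, rfl⟩
    exact Γ.isRationalPolyhedral_sigma hP ℓ S I
  · rintro C ⟨S, D, I, h, rfl⟩ p hp hp'
    ext q
    exact le_antisymm (neg_nonneg.1 ((mem_sigma_iff.1 hp').1 q)) ((mem_sigma_iff.1 hp).1 q)
  · rintro C₁ ⟨S, D, I, h, rfl⟩ C₂ ⟨S', D', I', h', rfl⟩ p hp q hq hpq
    rw [mem_sigma_iff] at hp hq hpq ⊢
    exact ⟨hp.1, h.mem_sigmaOrthant_of_add_mem hΓ h' hdeg hp.2 hq.2 hpq.2⟩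

theorem fanSupport_sigma (ℓ : E → P) (hΓ : Γ.Connected) {θ : V → ℝ} (hθ : Γ.IsNondegenerate θ)
    {δ : V → ℤ} (hdeg : ∑ v, θ v = ((∑ v, δ v : ℤ) : ℝ)) :
    fanSupport (withFaces {C | ∃ S D I, Γ.IsTriple θ δ S D I ∧ C = Γ.sigma ℓ S I}) =
      (dualCone P : Set (P →+ ℝ)) := by
  rw [fanSupport_withFaces]
  ext p
  constructor
  · rintro ⟨C, ⟨S, D, I, h, rfl⟩, hp⟩
    exact (mem_sigma_iff.1 hp).1
  · intro hp
    obtain ⟨S, D, I, h, hpC⟩ := exists_isTriple hΓ hθ hdeg (x := fun e => p (ℓ e)) fun e => hp _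
    exact ⟨_, ⟨S, D, I, h, rfl⟩, mem_sigma_iff.2 ⟨hp, hpC⟩⟩

end Multigraph

theorem mainTheorem9 {V E : Type*} [Fintype V] [DecidableEq V] [Fintype E] [DecidableEq E]
    (Γ : Multigraph V E) (hΓ : Γ.Connected) (θ : V → ℝ) (hθ : Γ.IsNondegenerate θ) :
    -- the case of a general base: `Γ` metrized by a sharp fs monoid `P`, any multidegree `δ`
    (∀ (P : Type*) [AddCommMonoid P], IsSharpFs P → ∀ (ℓ : E → P), (∀ e, ℓ e ≠ 0) →
      ∀ (d : ℤ) (δ : V → ℤ), ∑ v, θ v = d → ∑ v, δ v = d →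
      (∀ S D I, Γ.IsTriple θ δ S D I →
        IsConeIso ((latticeHom P).prod (latticeFun _)) (latticeHom P) (LinearMap.fst ℝ (P →+ ℝ) _)
          (Γ.tau ℓ S I) (Γ.sigma ℓ S I)) ∧
      IsFan (latticeHom P) (withFaces {C | ∃ S D I, Γ.IsTriple θ δ S D I ∧ C = Γ.sigma ℓ S I}) ∧
      fanSupport (withFaces {C | ∃ S D I, Γ.IsTriple θ δ S D I ∧ C = Γ.sigma ℓ S I}) =
        (Multigraph.dualCone P : Set (P →+ ℝ))) ∧
    -- the case of the moduli space of stable curves: `Γ` a stable graph, multidegree `deg_{k,A}`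
    (∀ (g n : ℕ) (gen : V → ℕ) (leg : Fin n → V), Γ.IsStableGraph g n gen leg →
      ∀ (k : ℤ) (A : Fin n → ℤ), ∑ i, A i = k * (2 * (g : ℤ) - 2 + n) → ∑ v, θ v = 0 →
      (∀ S D I, Γ.IsTriple θ (Γ.degKA gen leg k A) S D I →
        IsConeIso (latticeFun _) (latticeFun E) (Multigraph.prLen S)
          (Γ.tauOrthant S I) (Γ.sigmaOrthant S I)) ∧
      IsFan (latticeFun E)
        (withFaces {C | ∃ S D I, Γ.IsTriple θ (Γ.degKA gen leg k A) S D I ∧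
          C = Γ.sigmaOrthant S I}) ∧
      fanSupport (withFaces {C | ∃ S D I, Γ.IsTriple θ (Γ.degKA gen leg k A) S D I ∧
          C = Γ.sigmaOrthant S I}) =
        (Multigraph.orthant E : Set (E → ℝ))) := by
  refine ⟨fun P _ hP ℓ _ d δ hθd hδd => ?_, fun g n gen leg hst k A hA hθ0 => ?_⟩
  · have hdeg : ∑ v, θ v = ((∑ v, δ v : ℤ) : ℝ) := by rw [hθd, hδd]
    exact ⟨fun S D I h => h.isConeIso hΓ ℓ hdeg, Multigraph.isFan_sigma hP.fg ℓ hΓ hdeg,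
      Multigraph.fanSupport_sigma ℓ hΓ hθ hdeg⟩
  · have hdeg : ∑ v, θ v = ((∑ v, Γ.degKA gen leg k A v : ℤ) : ℝ) := by
      rw [hθ0, hst.sum_degKA k A hA, Int.cast_zero]
    exact ⟨fun S D I h => h.isConeIso_orthant hΓ hdeg, Multigraph.isFan_orthant hΓ hdeg,
      Multigraph.fanSupport_orthant hΓ hθ hdeg⟩
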